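/- For $N\ge 1$ let $\mathcal T_N$ (resp. $\mathcal T_{\le N}$) be the set of polynomials $P(z)=z+\sum_{j=2}^N a_jz^j$ of degree exactly $N$ (resp. at most $N$) that are typically real: for $|z|<1$, $P(z)$ is real if $z$ is real, and $\operatorname{Im}P(z)\cdot\operatorname{Im}z>0$ if $z$ is not real. (The coefficients are then real; for $N<3$ put $a_3=0$.) Let $U_m$ be the Chebyshev polynomial of the second kind of degree $m$. Put $D=1+z^4+2(1-2y^2)z^2$, and let $M=N+5$ if $N$ is odd, $M=N+4$ if $N$ is even. Define $$G_1(z,y)=\frac{32\,y^2(1-y^2)z^5}{(1-z^2)D^2}\cdot\frac{1-z^{M}}{M},\qquad G_2(z,y)=\frac{z+z^3}{D},$$ $$G_3(z,y)=\frac{-32\,y^2(1-y^2)z^7}{D^2}\cdot\frac{(M+2)^2(1-z^{M-2})+(M-2)^2(1-z^{M+2})-2(M-2)(M+2)(z^2-z^{M})}{(M-2)M(M+2)(1-z^2)^3},$$ $$G_4(z,y)=\frac{(z+z^3)\bigl(1+z^8-4y^2(z^2+z^6)+\gamma_2 z^4\bigr)}{(1-z^2)^2D^2},\qquad \gamma_2=2\Bigl(-\tfrac{16}{M}y^4+4\bigl(1+\tfrac4M\bigr)y^2-1\Bigr).$$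 **Theorem B.** In each of the following cases the indicated root $y$ exists. (a) Let $N$ be odd and $y$ the maximum root of $U_{(N+3)/2}$. Then $a_3$ has a unique maximizer $P$ in $\mathcal T_N$, and $P(z)=G_1(z,y)+G_2(z,y)$. (b) Let $N$ be even and $y$ the maximum root of $U_{(N+2)/2}$. Then the maximizers of $a_3$ in $\mathcal T_{\le N}$ are exactly the polynomials $$P_\tau(z)=\bigl(G_1(z,y)+G_2(z,y)\bigr)\Bigl(1+\tau\frac{z+z^{-1}}2\Bigr)-\frac\tau2,\qquad \tau\in[-1,1].$$ (c) Let $N$ and $(N+3)/2$ be odd and $y$ the minimum positive root of $U'_{(N+3)/2}$. Then $a_3$ has a unique minimizer $P$ in $\mathcal T_N$, and $P(z)=G_3(z,y)+G_4(z,y)$. (d) Let $N$ be odd, $(N+3)/2$ even and $y$ the minimum positive root of $U_{(N+3)/2}$. Then $a_3$ has a unique minimizer $P$ in $\mathcal T_N$, and $P(z)=G_1(z,y)+G_2(z,y)$. (e) Let $N$ be even, $(N+2)/2$ odd and $y$ the minimum positive root of $U'_{(N+2)/2}$. Then the minimizers of $a_3$ in $\mathcal T_{\le N}$ are exactly the polynomials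 $$P_\tau(z)=\bigl(G_3(z,y)+G_4(z,y)\bigr)\Bigl(1+\tau\frac{z+z^{-1}}2\Bigr)-\frac\tau2,\qquad \tau\in[-1,1].$$ (f) Let $N$ and $(N+2)/2$ be even and $y$ the minimum positive root of $U_{(N+2)/2}$. Then the minimizers of $a_3$ in $\mathcal T_{\le N}$ are exactly the polynomials $$P_\tau(z)=\bigl(G_1(z,y)+G_2(z,y)\bigr)\Bigl(1+\tau\frac{z+z^{-1}}2\Bigr)-\frac\tau2,\qquad \tau\in[-1,1].$$ In cases (a), (c), (d), $P$ is also the unique extremizer in $\mathcal T_{\le N}$; in cases (b), (e), (f), the extremizers in $\mathcal T_N$ are exactly the $P_\tau$ with $\tau\in[-1,1]\setminus\{0\}$. In every case all singularities of the rational function on the right (the zeros of $1-z^2$ and of $D$, and for even $N$ also $z=0$) are removable, the function so extended is the polynomial in question, and this polynomial has third coefficient $a_3=4y^2-1$. -/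

import Mathlib

open Filter Topology Set Polynomial

noncomputable section

namespace RogosinskiSzego

/-- A polynomial is typically real (on the open unit disc) if it takes real values at the real
points of the disc and `Im P(z) * Im z > 0` at the non-real points of the disc. -/
def TypicallyReal (P : ℂ[X]) : Prop :=
  (∀ z : ℂ, ‖z‖ < 1 → z.im = 0 → (P.eval z).im = 0) ∧
    ∀ z : ℂ, ‖z‖ < 1 → z.im ≠ 0 → 0 < (P.eval z).im * z.im

/-- Normalized typically real polynomials `z + a₂ z² + ⋯ + a_N z^N` of degree at most `N`. -/
def TypRealLE (N : ℕ) : Set ℂ[X] :=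
  {P | P.natDegree ≤ N ∧ P.coeff 0 = 0 ∧ P.coeff 1 = 1 ∧ TypicallyReal P}

/-- Normalized typically real polynomials `z + a₂ z² + ⋯ + a_N z^N` of exact degree `N`,
that is, with `a_N ≠ 0`. -/
def TypReal (N : ℕ) : Set ℂ[X] :=
  {P | P.natDegree = N ∧ P.coeff 0 = 0 ∧ P.coeff 1 = 1 ∧ TypicallyReal P}

/-- The members of the class `C` at which the third coefficient attains its maximum over `C`
(for typically real polynomials this coefficient is real). -/
def maximizers (C : Set ℂ[X]) : Set ℂ[X] :=
  {P | P ∈ C ∧ ∀ Q ∈ C, (Q.coeff 3).re ≤ (P.coeff 3).re}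

/-- The members of the class `C` at which the third coefficient attains its minimum over `C`. -/
def minimizers (C : Set ℂ[X]) : Set ℂ[X] :=
  {P | P ∈ C ∧ ∀ Q ∈ C, (P.coeff 3).re ≤ (Q.coeff 3).re}

/-- The set of real roots of the Chebyshev polynomial of the second kind `U_m`. -/
def rootsU (m : ℕ) : Set ℝ := {x | (Chebyshev.U ℝ (m : ℤ)).eval x = 0}

/-- The set of real roots of the derivative `U_m'`. -/
def rootsDU (m : ℕ) : Set ℝ := {x | (derivative (Chebyshev.U ℝ (m : ℤ))).eval x = 0}

/-- `y` is the smallest positive element of the set `S`. -/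
def IsMinPos (S : Set ℝ) (y : ℝ) : Prop := IsLeast {x | x ∈ S ∧ 0 < x} y

/-- The quartic `1 + z⁴ + 2 (1 - 2 y²) z²` occurring in the denominators. -/
def D (y z : ℂ) : ℂ := 1 + z ^ 4 + 2 * (1 - 2 * y ^ 2) * z ^ 2

def G₁ (N : ℕ) (y z : ℂ) : ℂ :=
  32 * (y ^ 2 * (1 - y ^ 2) * z ^ 5 / ((1 - z ^ 2) * D y z ^ 2)) *
    if Odd N then (1 - z ^ (N + 5)) / (N + 5) else (1 - z ^ (N + 4)) / (N + 4)

def G₂ (y z : ℂ) : ℂ := (z + z ^ 3) / D y z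

def G₃ (N : ℕ) (y z : ℂ) : ℂ :=
  -32 * y ^ 2 * (1 - y ^ 2) * z ^ 7 / D y z ^ 2 *
    if Odd N then
      ((N + 7) ^ 2 * (1 - z ^ (N + 3)) + (N + 3) ^ 2 * (1 - z ^ (N + 7))
          - 2 * (N + 3) * (N + 7) * (z ^ 2 - z ^ (N + 5))) /
        ((N + 3) * (N + 5) * (N + 7) * (1 - z ^ 2) ^ 3)
    else
      ((N + 6) ^ 2 * (1 - z ^ (N + 2)) + (N + 2) ^ 2 * (1 - z ^ (N + 6))
          - 2 * (N + 2) * (N + 6) * (z ^ 2 - z ^ (N + 4))) /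
        ((N + 2) * (N + 4) * (N + 6) * (1 - z ^ 2) ^ 3)

def γ₁ (y : ℂ) : ℂ := 4 * y ^ 2

def γ₂ (N : ℕ) (y : ℂ) : ℂ :=
  if Odd N then
    2 * (-(16 / (N + 5)) * y ^ 4 + 4 * (1 + 4 / (N + 5)) * y ^ 2 - 1)
  else
    2 * (-(16 / (N + 4)) * y ^ 4 + 4 * (1 + 4 / (N + 4)) * y ^ 2 - 1)

def G₄ (N : ℕ) (y z : ℂ) : ℂ :=
  (z + z ^ 3) * (1 + z ^ 8 - γ₁ y * (z ^ 2 + z ^ 6) + γ₂ N y * z ^ 4) /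
    ((1 - z ^ 2) ^ 2 * D y z ^ 2)

/-- From `F` form `F(z) (1 + τ (z + z⁻¹) / 2) - τ / 2`. -/
def withTau (τ : ℝ) (F : ℂ → ℂ) (z : ℂ) : ℂ :=
  F z * (1 + (τ : ℂ) * ((z + z⁻¹) / 2)) - (τ : ℂ) / 2

/-- The singular points (zeros of the denominators) of `G₁, …, G₄`. -/
def singularSet (y : ℂ) : Set ℂ := {z | 1 - z ^ 2 = 0 ∨ D y z = 0}

/-- `F` coincides with the polynomial `P` off the set `S` of its singular points, and every
singular point is removable: `F` extends there continuously, with value that of `P`. -/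
def PoleFreeRep (P : ℂ[X]) (F : ℂ → ℂ) (S : Set ℂ) : Prop :=
  (∀ z, z ∉ S → P.eval z = F z) ∧ ∀ z₀ ∈ S, Tendsto F (𝓝[≠] z₀) (𝓝 (P.eval z₀))

end RogosinskiSzego

end

open RogosinskiSzego

noncomputable section

namespace RogosinskiSzego

/-! ### The sine quotient of a polynomial and the Chebyshev functional -/

/-! On the unit circle a real polynomial `P(z) = ∑ aⱼ zʲ` satisfies `Im P(e^{it}) = u(cos t) sin t`
with `u = ∑ aⱼ Uⱼ₋₁` (`sineQuot`). If `a₁ = 1`, the maximum principle on the upper half disc shows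
that `P` is typically real exactly when `u ≥ 0` on `[-1, 1]` (`TypicallyReal.sineQuot_nonneg`,
`typicallyReal_of_sineQuot_nonneg`). Since the `Uⱼ` are orthonormal for `L = chebFun`, one has `L(u)
= a₁ = 1`, `L(x u) = a₂ / 2` and `L(x² u) = (a₃ + 1) / 4`. The problem is thus to extremize `L(x²
u)` over polynomials `u ≥ 0` on `[-1, 1]` of degree at most `N - 1` with `L(u) = 1`.

Let `m = (N + 3) / 2` or `(N + 2) / 2` according to parity. A quadrature formula for `L` with
positive weights, exact up to degree `2m - 1 ≥ N + 1`, writes `L(x² u)` as an average of `x²` over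
the nodes, so it lies between the extreme values of `x²` there (`IsNodeSet.chebFun_le`). If the
extreme value is taken at a pair `±y` only, equality forces `u` to vanish at all other nodes, doubly
at interior ones. This prescribes a factor of degree `2m - 4`, while `deg u ≤ N - 1`, which is `2m -
4` for odd `N` and `2m - 3` for even `N`. So `u` is unique for odd `N`; for even `N` it is unique up
to a factor `1 + τ x`, which is nonnegative on `[-1, 1]` exactly when `|τ| ≤ 1`
(`IsExtremalPoly.exists_sineQuot_eq_mul`, `mem_Icc_of_mul_nonneg`).

Gauss nodes, the roots of `U_m`, serve for the maximum, and for the minimum when `m` is even. For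
odd `m` they contain `0`, and the resulting bound is not sharp; the Lobatto nodes, `±1` and the
roots of `U_m'`, replace them.

Attainment comes from the explicit formulas. Their numerators are divisible by their denominators
(`gaussNum_dvd`, `lobattoNum_dvd`), and the resulting polynomials have `u` equal to a positive
multiple of `U_m² / (x² - y²)²`, respectively of `(1 - x²) U_m'² / (x² - y²)²`, hence nonnegative
(`exists_gaussPoly`, `exists_lobattoPoly`). -/

/-- The polynomial `∑ aⱼ Uⱼ₋₁` attached to `p = ∑ aⱼ Xʲ`. -/
def sineQuot (p : ℝ[X]) : ℝ[X] := p.sum fun j a => C a * Chebyshev.U ℝ ((j : ℤ) - 1)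

theorem sineQuot_eq_sum {p : ℝ[X]} {n : ℕ} (h : p.natDegree < n) :
    sineQuot p = ∑ j ∈ Finset.range n, C (p.coeff j) * Chebyshev.U ℝ ((j : ℤ) - 1) :=
  p.sum_over_range' (by simp) n h

/-- An algebraic form of `U_{j-1}(cos t) sin t = sin(j t)`. It is used on the unit circle, where it
gives imaginary parts and roots, and for real `z > 1`, where it turns polynomial identities into
rational ones. -/
theorem eval_U_joukowski {K : Type*} [Field K] [CharZero K] {z : K} (hz : z ≠ 0) (j : ℕ) :
    (Chebyshev.U K ((j : ℤ) - 1)).eval ((z + z⁻¹) / 2) * (z - z⁻¹) = z ^ j - (z⁻¹) ^ j := by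
  induction j using Nat.twoStepInduction with
  | zero => simp
  | one => simp
  | more n h₁ h₂ =>
    have e : (((n + 2 : ℕ) : ℤ) - 1) = ((n : ℤ) - 1) + 2 := by push_cast; ring
    have e' : (((n + 1 : ℕ) : ℤ) - 1) = ((n : ℤ) - 1) + 1 := by push_cast; ring
    rw [e'] at h₂
    rw [e, Chebyshev.U_add_two]
    have hzz : z * z⁻¹ = 1 := mul_inv_cancel₀ hz
    simp only [eval_sub, eval_mul, eval_ofNat, eval_X]
    linear_combination (z + z⁻¹) * h₂ - h₁ + (z ^ n - z⁻¹ ^ n) * hzz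

theorem eval_sineQuot_joukowski {K : Type*} [Field K] [CharZero K] (f : ℝ →+* K) (p : ℝ[X]) {z : K}
    (hz : z ≠ 0) :
    ((sineQuot p).map f).eval ((z + z⁻¹) / 2) * (z - z⁻¹) =
      (p.map f).eval z - (p.map f).eval z⁻¹ := by
  rw [sineQuot_eq_sum (Nat.lt_succ_self _), Polynomial.map_sum, eval_finsetSum, Finset.sum_mul,
    eval_map, eval_map, eval₂_eq_sum_range, eval₂_eq_sum_range, ← Finset.sum_sub_distrib]
  refine Finset.sum_congr rfl fun j _ => ?_
  rw [Polynomial.map_mul, map_C, Chebyshev.map_U, eval_mul, eval_C, mul_assoc,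
    eval_U_joukowski hz]
  ring

theorem natDegree_sineQuot_le (p : ℝ[X]) : (sineQuot p).natDegree ≤ p.natDegree - 1 := by
  rw [sineQuot_eq_sum (Nat.lt_succ_self _)]
  refine natDegree_sum_le_of_forall_le _ _ fun j hj => ?_
  refine natDegree_C_mul_le _ _ |>.trans ?_
  rw [Finset.mem_range] at hj
  cases j with
  | zero => simp
  | succ j =>
    rw [Nat.cast_succ, add_sub_cancel_right, Chebyshev.natDegree_U_natCast]
    omega

/-- `p ↦ (2/π) ∫ p(cos t) sin² t dt`, the functional for which the `Uⱼ` are orthonormal. -/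
def chebFun : ℝ[X] →ₗ[ℝ] ℝ where
  toFun p := 2 / Real.pi * ∫ t in (0 : ℝ)..Real.pi, p.eval (Real.cos t) * Real.sin t ^ 2
  map_add' p q := by
    rw [← mul_add, ← intervalIntegral.integral_add]
    · simp only [eval_add, add_mul]
    · exact Continuous.intervalIntegrable (by fun_prop) _ _
    · exact Continuous.intervalIntegrable (by fun_prop) _ _
  map_smul' c p := by
    simp only [eval_smul, smul_eq_mul, mul_assoc, intervalIntegral.integral_const_mul,
      RingHom.id_apply]
    ring

theorem chebFun_apply (p : ℝ[X]) : chebFun p =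
    2 / Real.pi * ∫ t in (0 : ℝ)..Real.pi, p.eval (Real.cos t) * Real.sin t ^ 2 := rfl

theorem integral_cos_int_mul (k : ℤ) :
    ∫ t in (0 : ℝ)..Real.pi, Real.cos (k * t) = if k = 0 then Real.pi else 0 := by
  split_ifs with h
  · simp [h]
  · rw [intervalIntegral.integral_comp_mul_left _ (by exact_mod_cast h)]
    simp [Real.sin_int_mul_pi]

theorem chebFun_U_mul_U (j k : ℕ) :
    chebFun (Chebyshev.U ℝ j * Chebyshev.U ℝ k) = if j = k then 1 else 0 := by
  have e : ∀ t : ℝ, (Chebyshev.U ℝ j * Chebyshev.U ℝ k).eval (Real.cos t) * Real.sin t ^ 2 =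
      (Real.cos (((j : ℤ) - k : ℤ) * t) - Real.cos (((j : ℤ) + k + 2 : ℤ) * t)) / 2 := by
    intro t
    have h₁ := Chebyshev.U_real_cos t j
    have h₂ := Chebyshev.U_real_cos t k
    have h₃ : Real.cos (((j : ℤ) - k : ℤ) * t) =
        Real.cos (((j : ℤ) + 1) * t - ((k : ℤ) + 1) * t) := by congr 1; push_cast; ring
    have h₄ : Real.cos (((j : ℤ) + k + 2 : ℤ) * t) =
        Real.cos (((j : ℤ) + 1) * t + ((k : ℤ) + 1) * t) := by congr 1; push_cast; ring
    rw [h₃, h₄, Real.cos_sub, Real.cos_add, eval_mul, ← h₁, ← h₂]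
    ring
  rw [chebFun_apply]
  simp only [e]
  rw [intervalIntegral.integral_div, intervalIntegral.integral_sub, integral_cos_int_mul,
    integral_cos_int_mul, if_neg (show (j : ℤ) + k + 2 ≠ 0 by omega)]
  · have : ((j : ℤ) - k = 0) ↔ j = k := by omega
    simp only [this]
    split_ifs
    · field_simp; simp
    · simp
  · exact Continuous.intervalIntegrable (by fun_prop) _ _
  · exact Continuous.intervalIntegrable (by fun_prop) _ _

theorem chebFun_sineQuot_mul_U (p : ℝ[X]) (k : ℕ) :
    chebFun (sineQuot p * Chebyshev.U ℝ k) = p.coeff (k + 1) := by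
  -- The summation range is enlarged so that it contains the index `k + 1` even beyond the degree of
  -- `p`.
  have hn : p.natDegree < max (p.natDegree + 1) (k + 2) := by omega
  rw [sineQuot_eq_sum hn, Finset.sum_mul, map_sum, Finset.sum_eq_single (k + 1)]
  · rw [Nat.cast_succ, add_sub_cancel_right, mul_assoc, ← smul_eq_C_mul, map_smul,
      chebFun_U_mul_U]
    simp
  · intro j _ hj
    cases j with
    | zero => simp
    | succ j =>
      rw [Nat.cast_succ, add_sub_cancel_right, mul_assoc, ← smul_eq_C_mul, map_smul,
        chebFun_U_mul_U, if_neg (by omega), smul_zero]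
  · intro h
    simp at h

theorem chebFun_sineQuot (p : ℝ[X]) : chebFun (sineQuot p) = p.coeff 1 := by
  simpa using chebFun_sineQuot_mul_U p 0

theorem chebFun_sineQuot_mul_X (p : ℝ[X]) : chebFun (sineQuot p * X) = p.coeff 2 / 2 := by
  have h := chebFun_sineQuot_mul_U p 1
  have e : sineQuot p * (2 * X) = (2 : ℝ) • (sineQuot p * X) := by
    rw [smul_eq_C_mul, C_ofNat]; ring
  rw [Nat.cast_one, Chebyshev.U_one, e, map_smul, smul_eq_mul] at h
  linarith

theorem chebFun_sineQuot_mul_sq (p : ℝ[X]) :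
    chebFun (sineQuot p * X ^ 2) = (p.coeff 3 + p.coeff 1) / 4 := by
  have h := chebFun_sineQuot_mul_U p 2
  have e : sineQuot p * (4 * X ^ 2 - 1) = (4 : ℝ) • (sineQuot p * X ^ 2) - sineQuot p := by
    rw [smul_eq_C_mul, C_ofNat]; ring
  rw [Nat.cast_ofNat, Chebyshev.U_two, e, map_sub, map_smul, smul_eq_mul, chebFun_sineQuot] at h
  norm_num at h
  linarith

/-- The constant term is invisible to `sineQuot` because `U₋₁ = 0`; all other coefficients are
recovered by orthonormality. -/
theorem sineQuot_inj {p q : ℝ[X]} (h₀ : p.coeff 0 = q.coeff 0) (h : sineQuot p = sineQuot q) :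
    p = q := by
  ext j
  cases j with
  | zero => exact h₀
  | succ j => rw [← chebFun_sineQuot_mul_U, ← chebFun_sineQuot_mul_U, h]

theorem exists_eval_ne_zero_mem_Ioo {p : ℝ[X]} (hp : p ≠ 0) {a b : ℝ} (hab : a < b) :
    ∃ x ∈ Ioo a b, p.eval x ≠ 0 := by
  by_contra! h
  exact hp (eq_zero_of_infinite_isRoot p ((Ioo_infinite hab).mono fun x hx => h x hx))

theorem chebFun_pos {p : ℝ[X]} (h : ∀ x ∈ Icc (-1 : ℝ) 1, 0 ≤ p.eval x) (hp : p ≠ 0) :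
    0 < chebFun p := by
  rw [chebFun_apply]
  have : 0 < ∫ t in (0 : ℝ)..Real.pi, p.eval (Real.cos t) * Real.sin t ^ 2 := by
    obtain ⟨x, hx, hpx⟩ := exists_eval_ne_zero_mem_Ioo hp (show (-1 : ℝ) < 1 by norm_num)
    have hx' : 0 < p.eval x := lt_of_le_of_ne (h x ⟨hx.1.le, hx.2.le⟩) hpx.symm
    refine intervalIntegral.integral_pos Real.pi_pos (by fun_prop) (fun t _ =>
      mul_nonneg (h _ ⟨Real.neg_one_le_cos t, Real.cos_le_one t⟩) (sq_nonneg _))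
      ⟨Real.arccos x, ⟨Real.arccos_nonneg x, Real.arccos_le_pi x⟩, ?_⟩
    rw [Real.cos_arccos hx.1.le hx.2.le, Real.sin_arccos, Real.sq_sqrt (by nlinarith [hx.1, hx.2])]
    exact mul_pos hx' (by nlinarith [hx.1, hx.2])
  have := Real.pi_pos
  positivity

theorem eval_nonneg_of_Ioo_diff_finite {p : ℝ[X]} {F : Set ℝ} (hF : F.Finite)
    (h : ∀ x ∈ Ioo (-1 : ℝ) 1, x ∉ F → 0 ≤ p.eval x) : ∀ x ∈ Icc (-1 : ℝ) 1, 0 ≤ p.eval x := by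
  have hd : Dense (Fᶜ) := hF.countable.dense_compl ℝ
  intro x hx
  rw [← closure_Ioo (show (-1 : ℝ) ≠ 1 by norm_num)] at hx
  exact closure_minimal ((hd.open_subset_closure_inter isOpen_Ioo).trans
    (closure_minimal (fun x hx => h x hx.1 hx.2) (isClosed_le continuous_const p.continuous)))
    (isClosed_le continuous_const p.continuous) hx

/-! ### Typically real polynomials and nonnegativity on `[-1, 1]` -/

theorem eval_map_ofReal_conj (p : ℝ[X]) (z : ℂ) :
    (p.map Complex.ofRealHom).eval (starRingEnd ℂ z) =
      starRingEnd ℂ ((p.map Complex.ofRealHom).eval z) := by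
  rw [eval_map, eval_map, hom_eval₂]
  congr 1
  ext x
  simp

theorem TypicallyReal.exists_real {P : ℂ[X]} (hP : TypicallyReal P) :
    ∃ p : ℝ[X], P = p.map Complex.ofRealHom := by
  have h : P.map (starRingEnd ℂ) = P := by
    refine eq_of_infinite_eval_eq _ _ ?_
    refine ((Ioo_infinite (show (-1 : ℝ) < 1 by norm_num)).image
      Complex.ofReal_injective.injOn).mono ?_
    rintro _ ⟨x, hx, rfl⟩
    have hx' : (P.eval (x : ℂ)).im = 0 := hP.1 x (by simpa [abs_lt] using hx) (by simp)
    have := Polynomial.eval_map_apply (f := starRingEnd ℂ) (p := P) (x : ℂ)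
    rw [Complex.conj_ofReal] at this
    rw [mem_ofPred_eq, this, Complex.conj_eq_iff_im.2 hx']
  have hl : P ∈ lifts Complex.ofRealHom := by
    rw [lifts_iff_coeff_lifts]
    intro n
    have hn := congrArg (fun Q : ℂ[X] => Q.coeff n) h
    simp only [coeff_map] at hn
    exact ⟨(P.coeff n).re, Complex.conj_eq_iff_re.1 hn⟩
  obtain ⟨p, hp⟩ := (mem_lifts _).1 hl
  exact ⟨p, hp.symm⟩

/-- On the unit circle `z⁻¹` is the conjugate of `z`, so both differences in
`eval_sineQuot_joukowski` are `2i` times imaginary parts. -/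
theorem im_eval_of_norm_eq_one (p : ℝ[X]) {z : ℂ} (hz : ‖z‖ = 1) :
    ((p.map Complex.ofRealHom).eval z).im = (sineQuot p).eval z.re * z.im := by
  have h0 : z ≠ 0 := by rintro rfl; simp at hz
  have hinv : z⁻¹ = starRingEnd ℂ z := Complex.inv_eq_conj hz
  have h := eval_sineQuot_joukowski Complex.ofRealHom p h0
  have hre : (z + starRingEnd ℂ z) / 2 = (z.re : ℂ) := by
    rw [Complex.add_conj]; push_cast; ring
  rw [hinv, hre, eval_map_ofReal_conj, Complex.sub_conj, Complex.sub_conj] at h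
  have h' := Polynomial.eval_map_apply (f := Complex.ofRealHom) (p := sineQuot p) z.re
  simp only [Complex.ofRealHom_eq_coe] at h'
  rw [h'] at h
  have := congrArg Complex.im h
  simp at this
  linarith

theorem TypicallyReal.sineQuot_nonneg {p : ℝ[X]}
    (hp : TypicallyReal (p.map Complex.ofRealHom)) :
    ∀ x ∈ Icc (-1 : ℝ) 1, 0 ≤ (sineQuot p).eval x := by
  refine eval_nonneg_of_Ioo_diff_finite finite_empty fun x hx _ => ?_
  set s := √(1 - x ^ 2) with hs
  have hs0 : 0 < s := Real.sqrt_pos.2 (by nlinarith [hx.1, hx.2])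
  have hs2 : s ^ 2 = 1 - x ^ 2 := Real.sq_sqrt (by nlinarith [hx.1, hx.2])
  set z : ℂ := ⟨x, s⟩ with hzdef
  have hz : ‖z‖ = 1 := by
    rw [← sq_eq_sq₀ (norm_nonneg _) zero_le_one, ← Complex.normSq_eq_norm_sq, Complex.normSq_apply]
    simp only [hzdef]
    linarith
  -- Typical reality is known only inside the disc, so the boundary point is reached by the radial
  -- limit `r → 1`.
  have hcl : IsClosed {r : ℝ | 0 ≤ ((p.map Complex.ofRealHom).eval ((r : ℂ) * z)).im} :=
    isClosed_le continuous_const (by fun_prop)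
  have hsub : Ioo (0 : ℝ) 1 ⊆ {r : ℝ | 0 ≤ ((p.map Complex.ofRealHom).eval ((r : ℂ) * z)).im} := by
    intro r hr
    have him : ((r : ℂ) * z).im = r * s := by simp [hzdef]
    have h := hp.2 ((r : ℂ) * z) (by
      rw [norm_mul, hz, mul_one, Complex.norm_real, Real.norm_of_nonneg hr.1.le]; exact hr.2)
      (by rw [him]; exact (mul_pos hr.1 hs0).ne')
    rw [him] at h
    exact (pos_of_mul_pos_left h (mul_pos hr.1 hs0).le).le
  have h1 : (1 : ℝ) ∈ closure (Ioo (0 : ℝ) 1) := by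
    rw [closure_Ioo zero_ne_one]; exact ⟨zero_le_one, le_rfl⟩
  have h := closure_minimal hsub hcl h1
  rw [mem_ofPred_eq, Complex.ofReal_one, one_mul, im_eval_of_norm_eq_one p hz] at h
  exact nonneg_of_mul_nonneg_left h hs0

theorem im_eval_pos_of_sineQuot_nonneg {p : ℝ[X]} (h1 : p.coeff 1 ≠ 0)
    (hp : ∀ x ∈ Icc (-1 : ℝ) 1, 0 ≤ (sineQuot p).eval x) {z : ℂ} (hz : ‖z‖ < 1) (him : 0 < z.im) :
    0 < ((p.map Complex.ofRealHom).eval z).im := by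
  set P := p.map Complex.ofRealHom with hP
  set U : Set ℂ := Metric.ball 0 1 ∩ {z | 0 < z.im} with hU
  have hUo : IsOpen U := Metric.isOpen_ball.inter (isOpen_lt continuous_const Complex.continuous_im)
  have hUb : Bornology.IsBounded U := Metric.isBounded_ball.subset inter_subset_left
  have hUc : IsPreconnected U :=
    ((convex_ball 0 1).inter (convex_halfSpace_im_gt 0)).isPreconnected
  -- `|exp(iP)| = exp(-Im P)`, so the maximum modulus principle for `f` is a minimum principle for
  -- `Im P`. On the diameter `Im P = 0`; on the arc `Im P` is `sineQuot p` times `Im z`.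
  set f : ℂ → ℂ := fun w => Complex.exp (Complex.I * P.eval w) with hf
  have hnorm : ∀ w, ‖f w‖ = Real.exp (-(P.eval w).im) := by
    intro w; simp [hf, Complex.norm_exp]
  have hfd : Differentiable ℂ f := by fun_prop
  have hfr : ∀ w ∈ frontier U, ‖f w‖ ≤ 1 := by
    intro w hw
    rw [hUo.frontier_eq] at hw
    have hc1 : w ∈ Metric.closedBall (0 : ℂ) 1 := closure_minimal
      (inter_subset_left.trans Metric.ball_subset_closedBall) Metric.isClosed_closedBall hw.1
    have hc2 : 0 ≤ w.im := closure_minimal (s := U) (t := {w : ℂ | 0 ≤ w.im})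
      (fun v hv => le_of_lt (show 0 < v.im from hv.2))
      (isClosed_le continuous_const Complex.continuous_im) hw.1
    rw [mem_closedBall_zero_iff] at hc1
    rw [hnorm, Real.exp_le_one_iff, neg_nonpos]
    rcases hc2.eq_or_lt with h0 | h0
    · have : starRingEnd ℂ w = w := Complex.conj_eq_iff_im.2 h0.symm
      have h := eval_map_ofReal_conj p w
      rw [this] at h
      exact (Complex.conj_eq_iff_im.1 h.symm).ge
    · rcases hc1.eq_or_lt with h' | h'
      · rw [im_eval_of_norm_eq_one p h']
        have := abs_le.1 ((Complex.abs_re_le_norm w).trans h'.le)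
        exact mul_nonneg (hp _ this) hc2
      · exact absurd ⟨mem_ball_zero_iff.2 h', h0⟩ hw.2
  have hzU : z ∈ U := ⟨mem_ball_zero_iff.2 hz, him⟩
  have hle : ∀ w ∈ U, ‖f w‖ ≤ 1 := fun w hw =>
    Complex.norm_le_of_forall_mem_frontier_norm_le hUb hfd.diffContOnCl hfr (subset_closure hw)
  have h0 : 0 ≤ (P.eval z).im := by
    have := hle z hzU
    rwa [hnorm, Real.exp_le_one_iff, neg_nonpos] at this
  -- An interior zero of `Im P` would make `f` constant on the half disc, hence `P' = 0`,
  -- contradicting `a₁ ≠ 0`.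
  refine lt_of_le_of_ne h0 fun heq => h1 ?_
  have hmax : IsMaxOn (norm ∘ f) U z := by
    intro w hw
    have : ‖f z‖ = 1 := by rw [hnorm, ← heq]; simp
    simpa [this] using hle w hw
  have hconst := Complex.eqOn_of_isPreconnected_of_isMaxOn_norm hUc hUo hfd.differentiableOn hzU hmax
  have hder : ∀ w ∈ U, (derivative P).eval w = 0 := by
    intro w hw
    have hev : f =ᶠ[𝓝 w] Function.const ℂ (f z) := hconst.eventuallyEq_of_mem (hUo.mem_nhds hw)
    have hd : HasDerivAt f (Complex.exp (Complex.I * P.eval w) *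
        (Complex.I * (derivative P).eval w)) w :=
      ((P.hasDerivAt w).const_mul Complex.I).cexp
    have := hd.unique ((hasDerivAt_const w (f z)).congr_of_eventuallyEq hev)
    simpa using this
  have hinf : U.Infinite := infinite_of_mem_nhds z (hUo.mem_nhds hzU)
  have hz : derivative P = 0 := eq_zero_of_infinite_isRoot _ (hinf.mono fun w hw => hder w hw)
  have := congrArg (fun Q : ℂ[X] => Q.coeff 0) hz
  simpa [coeff_derivative, hP] using this

theorem typicallyReal_of_sineQuot_nonneg {p : ℝ[X]} (h1 : p.coeff 1 ≠ 0)
    (hp : ∀ x ∈ Icc (-1 : ℝ) 1, 0 ≤ (sineQuot p).eval x) :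
    TypicallyReal (p.map Complex.ofRealHom) := by
  refine ⟨fun z _ him => ?_, fun z hz him => ?_⟩
  · have : starRingEnd ℂ z = z := Complex.conj_eq_iff_im.2 him
    have h := eval_map_ofReal_conj p z
    rw [this] at h
    exact Complex.conj_eq_iff_im.1 h.symm
  · rcases him.lt_or_gt with h | h
    · have := im_eval_pos_of_sineQuot_nonneg h1 hp (z := starRingEnd ℂ z) (by simpa using hz)
        (by simpa using h)
      rw [eval_map_ofReal_conj, Complex.conj_im] at this
      nlinarith
    · exact mul_pos (im_eval_pos_of_sineQuot_nonneg h1 hp hz h) h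

/-! ### Quadrature with positive weights -/

/-- The polynomial of least degree that is nonnegative on `[-1, 1]` and vanishes at `x`. -/
def nodeFactor (x : ℝ) : ℝ[X] :=
  if x = 1 then 1 - X else if x = -1 then 1 + X else (X - C x) ^ 2

theorem nodeFactor_one : nodeFactor 1 = 1 - X := by simp [nodeFactor]

theorem nodeFactor_neg_one : nodeFactor (-1) = 1 + X := by
  simp [nodeFactor, show (-1 : ℝ) ≠ 1 by norm_num]

theorem nodeFactor_of_mem_Ioo {x : ℝ} (hx : x ∈ Ioo (-1 : ℝ) 1) :
    nodeFactor x = (X - C x) ^ 2 := by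
  rw [nodeFactor, if_neg hx.2.ne, if_neg hx.1.ne']

theorem eval_nodeFactor_nonneg (x : ℝ) {u : ℝ} (hu : u ∈ Icc (-1 : ℝ) 1) :
    0 ≤ (nodeFactor x).eval u := by
  unfold nodeFactor
  split_ifs
  · simpa using hu.2
  · simp; linarith [hu.1]
  · simp; positivity

theorem eval_nodeFactor_eq_zero {x u : ℝ} : (nodeFactor x).eval u = 0 ↔ u = x := by
  unfold nodeFactor
  split_ifs with h₁ h₂
  · simp only [h₁, eval_sub, eval_one, eval_X]
    constructor <;> intro h <;> linarith
  · simp only [h₂, eval_add, eval_one, eval_X]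
    constructor <;> intro h <;> linarith
  · simp [sub_eq_zero]

theorem nodeFactor_ne_zero (x : ℝ) : nodeFactor x ≠ 0 := by
  intro h
  have h' := (eval_nodeFactor_eq_zero (x := x) (u := x + 1)).1 (by rw [h, eval_zero])
  linarith

theorem natDegree_one_sub_X : (1 - X : ℝ[X]).natDegree = 1 := by
  rw [← natDegree_neg, neg_sub, ← C_1, natDegree_X_sub_C]

theorem natDegree_one_add_X : (1 + X : ℝ[X]).natDegree = 1 := by
  rw [add_comm, ← C_1, natDegree_X_add_C]

theorem natDegree_nodeFactor_pos (x : ℝ) : 1 ≤ (nodeFactor x).natDegree := by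
  unfold nodeFactor
  split_ifs
  · rw [natDegree_one_sub_X]
  · rw [natDegree_one_add_X]
  · rw [natDegree_pow, natDegree_X_sub_C]; norm_num

theorem natDegree_nodeFactor_of_mem_Ioo {x : ℝ} (hx : x ∈ Ioo (-1 : ℝ) 1) :
    (nodeFactor x).natDegree = 2 := by
  rw [nodeFactor_of_mem_Ioo hx, natDegree_pow, natDegree_X_sub_C]

theorem eval_prod_nodeFactor_nonneg (A : Finset ℝ) {u : ℝ} (hu : u ∈ Icc (-1 : ℝ) 1) :
    0 ≤ (∏ x ∈ A, nodeFactor x).eval u := by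
  rw [eval_prod]
  exact Finset.prod_nonneg fun x _ => eval_nodeFactor_nonneg x hu

theorem eval_prod_nodeFactor_eq_zero (A : Finset ℝ) {u : ℝ} :
    (∏ x ∈ A, nodeFactor x).eval u = 0 ↔ u ∈ A := by
  simp [eval_prod, Finset.prod_eq_zero_iff, eval_nodeFactor_eq_zero]

theorem prod_nodeFactor_ne_zero (A : Finset ℝ) : ∏ x ∈ A, nodeFactor x ≠ 0 :=
  Finset.prod_ne_zero_iff.2 fun x _ => nodeFactor_ne_zero x

/-- At an interior zero a nonnegative polynomial has a local minimum, so the zero is at least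
double; at an endpoint only a simple zero is forced. -/
theorem nodeFactor_dvd {p : ℝ[X]} (hp : ∀ x ∈ Icc (-1 : ℝ) 1, 0 ≤ p.eval x) {x : ℝ}
    (hx : x ∈ Icc (-1 : ℝ) 1) (h0 : p.eval x = 0) : nodeFactor x ∣ p := by
  have hd : X - C x ∣ p := dvd_iff_isRoot.2 h0
  rcases hx.2.eq_or_lt with rfl | h1
  · rw [nodeFactor_one, ← neg_dvd, neg_sub, ← C_1]; exact hd
  rcases hx.1.eq_or_lt with rfl | h2
  · rw [nodeFactor_neg_one]; convert hd using 1; simp; ring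
  rw [nodeFactor_of_mem_Ioo ⟨h2, h1⟩]
  have hmin : IsLocalMin (fun u => p.eval u) x := by
    filter_upwards [Ioo_mem_nhds h2 h1] with u hu
    rw [h0]
    exact hp u ⟨hu.1.le, hu.2.le⟩
  have hder : (derivative p).eval x = 0 := hmin.hasDerivAt_eq_zero (p.hasDerivAt x)
  by_cases hp0 : p = 0
  · simp [hp0]
  · exact (le_rootMultiplicity_iff hp0).1
      ((one_lt_rootMultiplicity_iff_isRoot hp0).2 ⟨h0, hder⟩)

theorem isCoprime_nodeFactor {x y : ℝ} (h : x ≠ y) : IsCoprime (nodeFactor x) (nodeFactor y) := by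
  have key : ∀ x : ℝ, ∃ n : ℕ, nodeFactor x ∣ (X - C x) ^ n := by
    intro x
    unfold nodeFactor
    split_ifs with h₁ h₂
    · exact ⟨1, by rw [← neg_dvd, h₁]; simp⟩
    · exact ⟨1, by rw [h₂]; simp [add_comm]⟩
    · exact ⟨2, dvd_rfl⟩
  obtain ⟨k, hk⟩ := key x
  obtain ⟨l, hl⟩ := key y
  exact ((isCoprime_X_sub_C_of_isUnit_sub (sub_ne_zero.2 h).isUnit).pow
    (m := k) (n := l)).of_isCoprime_of_dvd_left hk |>.of_isCoprime_of_dvd_right hl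

theorem prod_nodeFactor_dvd {p : ℝ[X]} (hp : ∀ x ∈ Icc (-1 : ℝ) 1, 0 ≤ p.eval x) {A : Finset ℝ}
    (hA : ∀ x ∈ A, x ∈ Icc (-1 : ℝ) 1) (h0 : ∀ x ∈ A, p.eval x = 0) :
    ∏ x ∈ A, nodeFactor x ∣ p :=
  Finset.prod_dvd_of_coprime (fun _ _ _ _ h => isCoprime_nodeFactor h)
    fun x hx => nodeFactor_dvd hp (hA x hx) (h0 x hx)

/-- `s` is the node set of a Gauss type quadrature formula for `chebFun` that is exact in degrees
at most `2 * m - 1`. -/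
structure IsNodeSet (m : ℕ) (s : Finset ℝ) : Prop where
  mem_Icc : ∀ x ∈ s, x ∈ Icc (-1 : ℝ) 1
  natDegree_eq : (∏ x ∈ s, nodeFactor x).natDegree = 2 * m
  orthogonal : ∀ q : ℝ[X], q.natDegree + s.card ≤ 2 * m - 1 →
    chebFun (Lagrange.nodal s id * q) = 0

/-- Dividing by the nodal polynomial leaves the interpolating polynomial as remainder, and
orthogonality kills the quotient term; the weights are the values of `chebFun` on the Lagrange
basis. -/
theorem IsNodeSet.exists_weights {m : ℕ} {s : Finset ℝ} (hs : IsNodeSet m s) :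
    ∃ w : ℝ → ℝ, (∀ x ∈ s, 0 < w x) ∧
      ∀ p : ℝ[X], p.natDegree ≤ 2 * m - 1 → chebFun p = ∑ x ∈ s, w x * p.eval x := by
  classical
  have hq : ∀ p : ℝ[X], p.natDegree ≤ 2 * m - 1 →
      chebFun p = ∑ x ∈ s, chebFun (Lagrange.basis s id x) * p.eval x := by
    intro p hp
    have hm : (Lagrange.nodal s id : ℝ[X]).Monic := Lagrange.nodal_monic
    have hdeg : (Lagrange.nodal s id : ℝ[X]).natDegree = s.card := Lagrange.natDegree_nodal
    have h1 : chebFun (Lagrange.nodal s id * (p /ₘ Lagrange.nodal s id)) = 0 := by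
      rcases le_or_gt s.card p.natDegree with h | h
      · refine hs.orthogonal _ ?_
        rw [natDegree_divByMonic _ hm, hdeg]
        omega
      · rw [(divByMonic_eq_zero_iff hm).2 (degree_lt_degree (by rwa [hdeg])), mul_zero, map_zero]
    have h2 : p %ₘ Lagrange.nodal s id = ∑ x ∈ s, p.eval x • Lagrange.basis s id x := by
      have hlt : (p %ₘ Lagrange.nodal s id).degree < s.card := by
        have := degree_modByMonic_lt p hm
        rwa [Lagrange.degree_nodal] at this
      rw [Lagrange.eq_interpolate_of_eval_eq (v := id) (fun x => p.eval x)
        (fun x _ y _ h => h) hlt ?_, Lagrange.interpolate_apply]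
      · simp only [smul_eq_C_mul]
      · intro x hx
        have := congrArg (eval x) (modByMonic_add_div p (Lagrange.nodal s id))
        rw [eval_add, eval_mul, show eval x (Lagrange.nodal s (id : ℝ → ℝ)) = 0 from
          Lagrange.eval_nodal_at_node (v := id) hx, zero_mul, add_zero] at this
        exact this
    conv_lhs => rw [← modByMonic_add_div p (Lagrange.nodal s id)]
    rw [map_add, h1, add_zero, h2, map_sum]
    exact Finset.sum_congr rfl fun x _ => by rw [map_smul, smul_eq_mul, mul_comm]
  refine ⟨_, fun x hx => ?_, hq⟩
  -- Positivity of the weight at `x` is tested on a polynomial that is nonnegative on `[-1, 1]` and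
  -- vanishes at all nodes but `x`. Its degree is below `2m`, within the range of exactness.
  set t := ∏ y ∈ s.erase x, nodeFactor y with ht
  have htd : t.natDegree ≤ 2 * m - 1 := by
    have h := hs.natDegree_eq
    rw [← Finset.mul_prod_erase s _ hx,
      natDegree_mul (nodeFactor_ne_zero x) (prod_nodeFactor_ne_zero _), ← ht] at h
    have := natDegree_nodeFactor_pos x
    omega
  have htx : 0 < t.eval x :=
    lt_of_le_of_ne (eval_prod_nodeFactor_nonneg _ (hs.mem_Icc x hx)) fun h =>
      Finset.notMem_erase x s ((eval_prod_nodeFactor_eq_zero _).1 h.symm)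
  have hpos : 0 < chebFun t :=
    chebFun_pos (fun u hu => eval_prod_nodeFactor_nonneg _ hu) (prod_nodeFactor_ne_zero _)
  rw [hq t htd, Finset.sum_eq_single x] at hpos
  · exact pos_of_mul_pos_left hpos htx.le
  · intro y hy hyx
    rw [(eval_prod_nodeFactor_eq_zero _).2 (Finset.mem_erase.2 ⟨hyx, hy⟩), mul_zero]
  · exact fun h => absurd hx h

/-- `±y` are the nodes of `s` at which `ε * x ^ 2` is largest. -/
structure IsExtremalNode (ε : ℝ) (s : Finset ℝ) (y : ℝ) : Prop where
  mem_Ioo : y ∈ Ioo (0 : ℝ) 1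
  mem : y ∈ s
  neg_mem : -y ∈ s
  lt : ∀ x ∈ s, x ≠ y → x ≠ -y → ε * x ^ 2 < ε * y ^ 2

theorem IsNodeSet.chebFun_le {m : ℕ} {s : Finset ℝ} (hs : IsNodeSet m s) {ε y : ℝ}
    (hy : IsExtremalNode ε s y) {p : ℝ[X]} (hp : ∀ x ∈ Icc (-1 : ℝ) 1, 0 ≤ p.eval x)
    (hd : p.natDegree + 2 ≤ 2 * m - 1) :
    ε * chebFun (p * X ^ 2) ≤ ε * y ^ 2 * chebFun p ∧
      (ε * chebFun (p * X ^ 2) = ε * y ^ 2 * chebFun p →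
        ∏ x ∈ (s.erase y).erase (-y), nodeFactor x ∣ p) := by
  obtain ⟨w, hw, hq⟩ := hs.exists_weights
  have hd2 : (p * X ^ 2).natDegree ≤ 2 * m - 1 :=
    natDegree_mul_le.trans (by rw [natDegree_X_pow]; exact hd)
  -- The defect is a weighted sum of nonnegative terms, so it vanishes only if `p` does at every
  -- node other than `±y`.
  have key : ε * y ^ 2 * chebFun p - ε * chebFun (p * X ^ 2) =
      ∑ x ∈ s, w x * p.eval x * (ε * y ^ 2 - ε * x ^ 2) := by
    rw [hq p (by omega), hq _ hd2, Finset.mul_sum, Finset.mul_sum, ← Finset.sum_sub_distrib]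
    refine Finset.sum_congr rfl fun x _ => ?_
    simp
    ring
  have hterm : ∀ x ∈ s, 0 ≤ w x * p.eval x * (ε * y ^ 2 - ε * x ^ 2) := by
    intro x hx
    refine mul_nonneg (mul_nonneg (hw x hx).le (hp x (hs.mem_Icc x hx))) ?_
    by_cases h1 : x = y
    · simp [h1]
    by_cases h2 : x = -y
    · simp [h2]
    exact sub_nonneg.2 (hy.lt x hx h1 h2).le
  refine ⟨by linarith [Finset.sum_nonneg hterm], fun heq => ?_⟩
  rw [heq, sub_self, eq_comm, Finset.sum_eq_zero_iff_of_nonneg hterm] at key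
  have hmem : ∀ x ∈ (s.erase y).erase (-y), x ∈ s := fun x hx =>
    Finset.mem_of_mem_erase (Finset.mem_of_mem_erase hx)
  refine prod_nodeFactor_dvd hp (fun x hx => hs.mem_Icc x (hmem x hx)) fun x hx => ?_
  have hxs := hmem x hx
  rw [Finset.mem_erase, Finset.mem_erase] at hx
  have := key x hxs
  rcases mul_eq_zero.1 this with h | h
  · exact (mul_eq_zero.1 h).resolve_left (hw x hxs).ne'
  · linarith [hy.lt x hxs hx.2.1 hx.1]

theorem IsNodeSet.natDegree_prod_erase {m : ℕ} {s : Finset ℝ} (hs : IsNodeSet m s) {ε y : ℝ}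
    (hy : IsExtremalNode ε s y) :
    (∏ x ∈ (s.erase y).erase (-y), nodeFactor x).natDegree + 4 = 2 * m := by
  have h0 := hy.mem_Ioo.1
  have h1 := hy.mem_Ioo.2
  have h := hs.natDegree_eq
  rw [← Finset.mul_prod_erase s _ hy.mem,
    ← Finset.mul_prod_erase (s.erase y) _ (a := -y)
      (Finset.mem_erase.2 ⟨by linarith, hy.neg_mem⟩),
    natDegree_mul (nodeFactor_ne_zero _)
      (mul_ne_zero (nodeFactor_ne_zero _) (prod_nodeFactor_ne_zero _)),
    natDegree_mul (nodeFactor_ne_zero _) (prod_nodeFactor_ne_zero _),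
    natDegree_nodeFactor_of_mem_Ioo ⟨by linarith, h1⟩,
    natDegree_nodeFactor_of_mem_Ioo ⟨by linarith, by linarith⟩] at h
  omega

/-! ### The node sets attached to `U_m` and to `U_m'` -/

/-- The recurrence `2 X U_{k+1} = U_{k+2} + U_k` trades one power of `X` for a shift of the index by
one. -/
theorem chebFun_U_mul_X_pow {j n : ℕ} (h : j < n) :
    chebFun (Chebyshev.U ℝ n * X ^ j) = 0 := by
  induction j generalizing n with
  | zero =>
    have := chebFun_U_mul_U n 0
    rw [if_neg (by omega)] at this
    simpa using this
  | succ j ih =>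
    obtain ⟨k, rfl⟩ : ∃ k, n = k + 1 := ⟨n - 1, by omega⟩
    have h₁ := ih (n := k) (by omega)
    have h₂ := ih (n := k + 2) (by omega)
    have e : (2 : ℝ) • (Chebyshev.U ℝ ((k + 1 : ℕ) : ℤ) * X ^ (j + 1)) =
        Chebyshev.U ℝ ((k + 2 : ℕ) : ℤ) * X ^ j + Chebyshev.U ℝ (k : ℤ) * X ^ j := by
      push_cast
      rw [Chebyshev.U_add_two, smul_eq_C_mul, C_ofNat]
      ring
    have := congrArg chebFun e
    rw [map_add, h₁, h₂, map_smul, smul_eq_mul] at this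
    linarith

theorem chebFun_U_mul {n : ℕ} {q : ℝ[X]} (h : q.natDegree < n) :
    chebFun (Chebyshev.U ℝ n * q) = 0 := by
  rw [q.as_sum_range_C_mul_X_pow, Finset.mul_sum, map_sum]
  refine Finset.sum_eq_zero fun j hj => ?_
  rw [mul_left_comm, ← smul_eq_C_mul, map_smul, chebFun_U_mul_X_pow, smul_zero]
  rw [Finset.mem_range] at hj
  omega

theorem exists_eq_C_mul_nodal {W : ℝ[X]} {s : Finset ℝ} (hW : W ≠ 0) (hd : W.natDegree ≤ s.card)
    (h0 : ∀ x ∈ s, W.eval x = 0) : ∃ a : ℝ, a ≠ 0 ∧ W = C a * Lagrange.nodal s id := by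
  have hdvd : Lagrange.nodal s id ∣ W := by
    rw [Lagrange.nodal_eq]
    exact Finset.prod_dvd_of_coprime
      (fun x _ y _ h => isCoprime_X_sub_C_of_isUnit_sub (sub_ne_zero.2 h).isUnit)
      fun x hx => dvd_iff_isRoot.2 (h0 x hx)
  obtain ⟨r, rfl⟩ := hdvd
  have hr : r ≠ 0 := right_ne_zero_of_mul hW
  rw [natDegree_mul (left_ne_zero_of_mul hW) hr, Lagrange.natDegree_nodal] at hd
  rw [eq_C_of_natDegree_eq_zero (show r.natDegree = 0 by omega)] at hr ⊢
  exact ⟨_, by simpa using hr, mul_comm _ _⟩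

theorem isNodeSet_of_orthogonal {m : ℕ} {s : Finset ℝ} {W : ℝ[X]} (hW : W ≠ 0)
    (hd : W.natDegree ≤ s.card) (h0 : ∀ x ∈ s, W.eval x = 0)
    (hs : ∀ x ∈ s, x ∈ Icc (-1 : ℝ) 1) (hf : (∏ x ∈ s, nodeFactor x).natDegree = 2 * m)
    (ho : ∀ q : ℝ[X], q.natDegree + s.card ≤ 2 * m - 1 → chebFun (W * q) = 0) :
    IsNodeSet m s := by
  refine ⟨hs, hf, fun q hq => ?_⟩
  obtain ⟨a, ha, rfl⟩ := exists_eq_C_mul_nodal hW hd h0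
  have := ho q hq
  rw [mul_assoc, ← smul_eq_C_mul, map_smul, smul_eq_zero] at this
  exact this.resolve_left ha

theorem natDegree_prod_nodeFactor {s : Finset ℝ} (hs : ∀ x ∈ s, x ∈ Ioo (-1 : ℝ) 1) :
    (∏ x ∈ s, nodeFactor x).natDegree = 2 * s.card := by
  rw [natDegree_prod _ _ fun x _ => nodeFactor_ne_zero x,
    Finset.sum_congr rfl fun x hx => natDegree_nodeFactor_of_mem_Ioo (hs x hx)]
  simp [mul_comm]

/-- The roots of `U_m`. -/
def gaussNodes (m : ℕ) : Finset ℝ := (Chebyshev.U ℝ m).roots.toFinset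

theorem mem_gaussNodes {m : ℕ} {x : ℝ} : x ∈ gaussNodes m ↔ (Chebyshev.U ℝ m).eval x = 0 := by
  rw [gaussNodes, Multiset.mem_toFinset, mem_roots (Chebyshev.U_ne_zero ℝ _ (by omega)), IsRoot]

theorem coe_gaussNodes (m : ℕ) : (gaussNodes m : Set ℝ) = rootsU m :=
  Set.ext fun _ => mem_gaussNodes

theorem card_gaussNodes (m : ℕ) : (gaussNodes m).card = m := by
  rw [gaussNodes, Chebyshev.roots_U_real, Finset.val_toFinset,
    Finset.card_image_of_injOn ((Finset.range m).nodup_map_iff_injOn.mp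
      (Chebyshev.roots_U_real_nodup m)), Finset.card_range]

theorem gaussNodes_subset_Ioo {m : ℕ} {x : ℝ} (hx : x ∈ gaussNodes m) : x ∈ Ioo (-1 : ℝ) 1 := by
  rw [gaussNodes, Chebyshev.roots_U_real, Finset.val_toFinset, Finset.mem_image] at hx
  obtain ⟨k, hk, rfl⟩ := hx
  rw [Finset.mem_range] at hk
  have hk' : (k : ℝ) + 1 < m + 1 := by exact_mod_cast Nat.succ_lt_succ hk
  have h0 : 0 < ((k : ℝ) + 1) * Real.pi / (m + 1) := by positivity
  have h1 : ((k : ℝ) + 1) * Real.pi / (m + 1) < Real.pi := by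
    rw [div_lt_iff₀ (by positivity)]
    nlinarith [Real.pi_pos]
  constructor
  · rw [← Real.cos_pi]; exact Real.cos_lt_cos_of_nonneg_of_le_pi h0.le le_rfl h1
  · have := Real.cos_lt_cos_of_nonneg_of_le_pi le_rfl h1.le h0
    rwa [Real.cos_zero] at this

theorem neg_mem_gaussNodes {m : ℕ} {x : ℝ} (hx : x ∈ gaussNodes m) : -x ∈ gaussNodes m := by
  rw [mem_gaussNodes] at hx ⊢
  rw [Chebyshev.U_eval_neg, hx, mul_zero]

theorem isNodeSet_gaussNodes {m : ℕ} (hm : 1 ≤ m) : IsNodeSet m (gaussNodes m) := by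
  refine isNodeSet_of_orthogonal (Chebyshev.U_ne_zero ℝ (m : ℤ) (by omega)) ?_
    (fun x hx => mem_gaussNodes.1 hx) (fun x hx => Ioo_subset_Icc_self (gaussNodes_subset_Ioo hx))
    ?_ fun q hq => ?_
  · rw [Chebyshev.natDegree_U_natCast, card_gaussNodes]
  · rw [natDegree_prod_nodeFactor fun x hx => gaussNodes_subset_Ioo hx, card_gaussNodes]
  · rw [card_gaussNodes] at hq
    exact chebFun_U_mul (by omega)

/-! ### Lobatto nodes: `±1` and the critical points of `U_m`. -/

theorem one_sub_sq_mul_derivative_U (m : ℕ) :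
    (1 - X ^ 2) * derivative (Chebyshev.U ℝ ((m + 1 : ℕ) : ℤ)) =
      C (1 / 2 : ℝ) * (C ((m : ℝ) + 3) * Chebyshev.U ℝ m -
        C ((m : ℝ) + 1) * Chebyshev.U ℝ ((m + 2 : ℕ) : ℤ)) := by
  have h₁ := Chebyshev.add_one_mul_T_eq_poly_in_U (R := ℝ) ((m + 1 : ℕ) : ℤ)
  have h₂ := Chebyshev.two_mul_T_eq_U_sub_U (R := ℝ) (m : ℤ)
  have h₃ := Chebyshev.U_add_two ℝ (m : ℤ)
  have hc : C (1 / 2 : ℝ) * 2 = 1 := by rw [← C_ofNat, ← C_mul]; norm_num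
  push_cast at h₁ h₂ h₃ ⊢
  rw [show (m : ℤ) + 1 + 1 = m + 2 by ring] at h₁
  simp only [map_add, map_natCast, map_ofNat, map_one] at h₁ ⊢
  linear_combination h₁ - C (1 / 2 : ℝ) * (m + 2) * h₂ - C (1 / 2 : ℝ) * h₃ +
    ((m + 2) * Chebyshev.T ℝ (m + 2) - X * Chebyshev.U ℝ (m + 1)) * hc

/-- The Lobatto nodal polynomial is, up to a constant, a combination of `U_m` and `U_{m+2}`, and
both are orthogonal to degrees below `m`. -/
theorem chebFun_derivative_U_mul {m : ℕ} {q : ℝ[X]} (h : q.natDegree < m) :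
    chebFun ((1 - X ^ 2) * derivative (Chebyshev.U ℝ ((m + 1 : ℕ) : ℤ)) * q) = 0 := by
  have e : (1 - X ^ 2) * derivative (Chebyshev.U ℝ ((m + 1 : ℕ) : ℤ)) * q =
      (1 / 2 : ℝ) • (((m : ℝ) + 3) • (Chebyshev.U ℝ m * q) -
        ((m : ℝ) + 1) • (Chebyshev.U ℝ ((m + 2 : ℕ) : ℤ) * q)) := by
    rw [one_sub_sq_mul_derivative_U]
    simp only [smul_eq_C_mul]
    ring
  rw [e, map_smul, map_sub, map_smul, map_smul, chebFun_U_mul h, chebFun_U_mul (by omega)]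
  simp

/-- The recurrence propagates growth of both `U` and `U'` on `[1, ∞)`. With the parity of `U'` this
confines the roots of `U'` to `(-1, 1)`. -/
theorem derivative_U_pos {x : ℝ} (hx : 1 ≤ x) (m : ℕ) :
    (1 ≤ (Chebyshev.U ℝ m).eval x ∧
      (Chebyshev.U ℝ m).eval x ≤ (Chebyshev.U ℝ ((m + 1 : ℕ) : ℤ)).eval x) ∧
    (derivative (Chebyshev.U ℝ m)).eval x ≤
        (derivative (Chebyshev.U ℝ ((m + 1 : ℕ) : ℤ))).eval x ∧
      0 < (derivative (Chebyshev.U ℝ ((m + 1 : ℕ) : ℤ))).eval x := by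
  induction m with
  | zero => simp; linarith
  | succ m ih =>
    obtain ⟨⟨h1, h2⟩, h3, h4⟩ := ih
    have e := Chebyshev.U_add_two ℝ (m : ℤ)
    push_cast at *
    rw [show (m : ℤ) + 1 + 1 = m + 2 by ring, e]
    simp
    refine ⟨⟨by linarith, by nlinarith⟩, by nlinarith, by nlinarith⟩

theorem derivative_U_eval_neg (m : ℕ) (x : ℝ) : (derivative (Chebyshev.U ℝ m)).eval (-x) =
    -((-1) ^ m * (derivative (Chebyshev.U ℝ m)).eval x) := by
  have h : (Chebyshev.U ℝ m).comp (-X) = C ((-1 : ℝ) ^ m) * Chebyshev.U ℝ m := by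
    refine funext fun x => ?_
    simp
  generalize (-1 : ℝ) ^ m = e at h ⊢
  have h' := congrArg (fun p => (derivative p).eval x) h
  simp [derivative_comp] at h'
  linarith

/-- The roots of `U_m'`. -/
def innerLobattoNodes (m : ℕ) : Finset ℝ := (derivative (Chebyshev.U ℝ m)).roots.toFinset

/-- The points `±1` and the roots of `U_m'`. -/
def lobattoNodes (m : ℕ) : Finset ℝ := insert 1 (insert (-1) (innerLobattoNodes m))

theorem derivative_U_ne_zero {m : ℕ} (hm : 1 ≤ m) : derivative (Chebyshev.U ℝ m) ≠ 0 := by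
  obtain ⟨k, rfl⟩ : ∃ k, m = k + 1 := ⟨m - 1, by omega⟩
  intro h
  have := (derivative_U_pos le_rfl k).2.2
  rw [h, eval_zero] at this
  exact this.false

theorem mem_innerLobattoNodes {m : ℕ} (hm : 1 ≤ m) {x : ℝ} :
    x ∈ innerLobattoNodes m ↔ (derivative (Chebyshev.U ℝ m)).eval x = 0 := by
  rw [innerLobattoNodes, Multiset.mem_toFinset, mem_roots (derivative_U_ne_zero hm), IsRoot]

theorem coe_innerLobattoNodes {m : ℕ} (hm : 1 ≤ m) :
    (innerLobattoNodes m : Set ℝ) = rootsDU m :=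
  Set.ext fun _ => mem_innerLobattoNodes hm

theorem neg_mem_innerLobattoNodes {m : ℕ} (hm : 1 ≤ m) {x : ℝ} (hx : x ∈ innerLobattoNodes m) :
    -x ∈ innerLobattoNodes m := by
  rw [mem_innerLobattoNodes hm] at hx ⊢
  rw [derivative_U_eval_neg, hx, mul_zero, neg_zero]

theorem innerLobattoNodes_subset_Ioo {m : ℕ} (hm : 1 ≤ m) {x : ℝ} (hx : x ∈ innerLobattoNodes m) :
    x ∈ Ioo (-1 : ℝ) 1 := by
  obtain ⟨k, rfl⟩ : ∃ k, m = k + 1 := ⟨m - 1, by omega⟩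
  have key : ∀ u ∈ innerLobattoNodes (k + 1), u < 1 := by
    intro u hu
    by_contra! h
    have := (derivative_U_pos h k).2.2
    rw [(mem_innerLobattoNodes hm).1 hu] at this
    exact this.false
  exact ⟨by linarith [key _ (neg_mem_innerLobattoNodes hm hx)], key x hx⟩

theorem natDegree_derivative_U (m : ℕ) : (derivative (Chebyshev.U ℝ m)).natDegree ≤ m - 1 := by
  have := natDegree_derivative_le (Chebyshev.U ℝ m)
  rwa [Chebyshev.natDegree_U_natCast] at this

theorem card_innerLobattoNodes (m : ℕ) : (innerLobattoNodes m).card = m - 1 := by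
  refine le_antisymm ?_ ?_
  · exact (Multiset.toFinset_card_le _).trans ((card_roots' _).trans (natDegree_derivative_U m))
  · have := card_roots_toFinset_le_derivative (Chebyshev.U ℝ m)
    change (gaussNodes m).card ≤ (innerLobattoNodes m).card + 1 at this
    rw [card_gaussNodes] at this
    omega

theorem card_lobattoNodes {m : ℕ} (hm : 1 ≤ m) : (lobattoNodes m).card = m + 1 := by
  have h1 : (-1 : ℝ) ∉ innerLobattoNodes m := fun h =>
    (innerLobattoNodes_subset_Ioo hm h).1.false
  have h2 : (1 : ℝ) ∉ insert (-1) (innerLobattoNodes m) := by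
    rw [Finset.mem_insert, not_or]
    exact ⟨by norm_num, fun h => (innerLobattoNodes_subset_Ioo hm h).2.false⟩
  rw [lobattoNodes, Finset.card_insert_of_notMem h2, Finset.card_insert_of_notMem h1,
    card_innerLobattoNodes]
  omega

theorem isNodeSet_lobattoNodes {m : ℕ} (hm : 2 ≤ m) : IsNodeSet m (lobattoNodes m) := by
  have hm1 : 1 ≤ m := by omega
  have h1 : (-1 : ℝ) ∉ innerLobattoNodes m := fun h =>
    (innerLobattoNodes_subset_Ioo hm1 h).1.false
  have h2 : (1 : ℝ) ∉ insert (-1) (innerLobattoNodes m) := by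
    rw [Finset.mem_insert, not_or]
    exact ⟨by norm_num, fun h => (innerLobattoNodes_subset_Ioo hm1 h).2.false⟩
  have hX : (1 - X ^ 2 : ℝ[X]) ≠ 0 := by
    intro h
    have := congrArg (eval 0) h
    simp at this
  refine isNodeSet_of_orthogonal (W := (1 - X ^ 2) * derivative (Chebyshev.U ℝ m))
    (mul_ne_zero hX (derivative_U_ne_zero hm1)) ?_ ?_ ?_ ?_ fun q hq => ?_
  · rw [card_lobattoNodes hm1]
    have hX2 : (1 - X ^ 2 : ℝ[X]).natDegree ≤ 2 := by compute_degree
    have := natDegree_derivative_U m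
    refine natDegree_mul_le.trans ?_
    omega
  · intro x hx
    rw [lobattoNodes, Finset.mem_insert, Finset.mem_insert] at hx
    rcases hx with rfl | rfl | hx
    · simp
    · simp
    · rw [eval_mul, (mem_innerLobattoNodes hm1).1 hx, mul_zero]
  · intro x hx
    rw [lobattoNodes, Finset.mem_insert, Finset.mem_insert] at hx
    rcases hx with rfl | rfl | hx
    · norm_num
    · norm_num
    · exact Ioo_subset_Icc_self (innerLobattoNodes_subset_Ioo hm1 hx)
  · rw [lobattoNodes, Finset.prod_insert h2, Finset.prod_insert h1,
      natDegree_mul (nodeFactor_ne_zero _) (mul_ne_zero (nodeFactor_ne_zero _)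
        (prod_nodeFactor_ne_zero _)),
      natDegree_mul (nodeFactor_ne_zero _) (prod_nodeFactor_ne_zero _), nodeFactor_one,
      nodeFactor_neg_one, natDegree_one_sub_X, natDegree_one_add_X,
      natDegree_prod_nodeFactor fun x hx => innerLobattoNodes_subset_Ioo hm1 hx,
      card_innerLobattoNodes]
    omega
  · rw [card_lobattoNodes hm1] at hq
    obtain ⟨k, rfl⟩ : ∃ k, m = k + 1 := ⟨m - 1, by omega⟩
    exact chebFun_derivative_U_mul (by omega)

/-! ### Existence of the extremal pair of nodes. -/

theorem isExtremalNode_one {s : Finset ℝ} (hneg : ∀ x ∈ s, -x ∈ s)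
    {y : ℝ} (hy : IsGreatest (s : Set ℝ) y) (hy0 : 0 < y) (hy1 : y < 1) : IsExtremalNode 1 s y := by
  refine ⟨⟨hy0, hy1⟩, hy.1, hneg y hy.1, fun x hx h1 h2 => ?_⟩
  have h3 : x < y := lt_of_le_of_ne (hy.2 hx) h1
  have h4 : -x < y := lt_of_le_of_ne (hy.2 (hneg x hx)) fun h => h2 (by linarith)
  nlinarith

theorem isExtremalNode_neg_one {s : Finset ℝ} (hneg : ∀ x ∈ s, -x ∈ s) (h0 : (0 : ℝ) ∉ s)
    {y : ℝ} (hy : IsMinPos (s : Set ℝ) y) (hy1 : y < 1) : IsExtremalNode (-1) s y := by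
  refine ⟨⟨hy.1.2, hy1⟩, hy.1.1, hneg y hy.1.1, fun x hx h1 h2 => ?_⟩
  have hy0 : 0 < y := hy.1.2
  have key : ∀ u ∈ s, u ≠ y → 0 < u → y < u := fun u hu hne hu0 =>
    lt_of_le_of_ne (hy.2 ⟨hu, hu0⟩) hne.symm
  have hx0 : x ≠ 0 := fun h => h0 (h ▸ hx)
  rcases hx0.lt_or_gt with h | h
  · have := key (-x) (hneg x hx) (fun h => h2 (by linarith)) (by linarith)
    nlinarith
  · have := key x hx h1 h
    nlinarith

theorem exists_pos_mem {s : Finset ℝ} (hneg : ∀ x ∈ s, -x ∈ s) (hs : 2 ≤ s.card) :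
    ∃ x ∈ s, 0 < x := by
  obtain ⟨x, hx, hx0⟩ := Finset.exists_mem_ne (by omega : 1 < s.card) 0
  rcases hx0.lt_or_gt with h | h
  · exact ⟨-x, hneg x hx, by linarith⟩
  · exact ⟨x, hx, h⟩

theorem exists_isGreatest_pos {s : Finset ℝ} (hneg : ∀ x ∈ s, -x ∈ s) (hs : 2 ≤ s.card) :
    ∃ y, IsGreatest (s : Set ℝ) y ∧ 0 < y := by
  obtain ⟨x, hx, hx0⟩ := exists_pos_mem hneg hs
  have h := s.isGreatest_max' ⟨x, hx⟩
  exact ⟨_, h, hx0.trans_le (h.2 hx)⟩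

theorem exists_isMinPos {s : Finset ℝ} (hneg : ∀ x ∈ s, -x ∈ s) (hs : 2 ≤ s.card) :
    ∃ y, IsMinPos (s : Set ℝ) y := by
  obtain ⟨x, hx, hx0⟩ := exists_pos_mem hneg hs
  have h := (s.filter (0 < ·)).isLeast_min' ⟨x, Finset.mem_filter.2 ⟨hx, hx0⟩⟩
  rw [Finset.coe_filter] at h
  exact ⟨_, h⟩

theorem exists_maximal_gaussNode {m : ℕ} (hm : 2 ≤ m) :
    ∃ y, IsGreatest (rootsU m) y ∧ IsExtremalNode 1 (gaussNodes m) y := by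
  obtain ⟨y, hy, hy0⟩ := exists_isGreatest_pos (s := gaussNodes m)
    (fun x => neg_mem_gaussNodes) (by rwa [card_gaussNodes])
  exact ⟨y, coe_gaussNodes m ▸ hy, isExtremalNode_one (fun x => neg_mem_gaussNodes) hy hy0
    (gaussNodes_subset_Ioo hy.1).2⟩

theorem exists_minimal_gaussNode {m : ℕ} (hm : 2 ≤ m) (he : Even m) :
    ∃ y, IsMinPos (rootsU m) y ∧ IsExtremalNode (-1) (gaussNodes m) y := by
  obtain ⟨y, hy⟩ := exists_isMinPos (s := gaussNodes m)
    (fun x => neg_mem_gaussNodes) (by rwa [card_gaussNodes])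
  refine ⟨y, coe_gaussNodes m ▸ hy, isExtremalNode_neg_one (fun x => neg_mem_gaussNodes) ?_ hy
    (gaussNodes_subset_Ioo hy.1.1).2⟩
  rw [mem_gaussNodes, Chebyshev.U_eval_zero_of_even ℝ (by exact_mod_cast he)]
  simp

theorem exists_minimal_lobattoNode {m : ℕ} (hm : 3 ≤ m) (ho : Odd m) :
    ∃ y, IsMinPos (rootsDU m) y ∧ IsExtremalNode (-1) (lobattoNodes m) y := by
  have hm1 : 1 ≤ m := by omega
  obtain ⟨y, hy⟩ := exists_isMinPos (s := innerLobattoNodes m)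
    (fun x => neg_mem_innerLobattoNodes hm1) (by rw [card_innerLobattoNodes]; omega)
  have hy1 := (innerLobattoNodes_subset_Ioo hm1 hy.1.1).2
  refine ⟨y, coe_innerLobattoNodes hm1 ▸ hy, isExtremalNode_neg_one (fun x hx => ?_) ?_ ?_ hy1⟩
  · simp only [lobattoNodes, Finset.mem_insert] at hx ⊢
    rcases hx with rfl | rfl | hx
    · simp
    · simp
    · exact Or.inr (Or.inr (neg_mem_innerLobattoNodes hm1 hx))
  · have hU : (Chebyshev.U ℝ m).eval 0 = 0 :=
      Chebyshev.U_eval_zero_of_odd ℝ (by exact_mod_cast ho)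
    -- Rolle's theorem yields `m - 1` roots of `U_m'` that are not roots of `U_m`. As these are all
    -- the roots of `U_m'`, the common point `0` cannot be one of them.
    have hd : (derivative (Chebyshev.U ℝ m)).eval 0 ≠ 0 := by
      intro hd
      have h := card_roots_toFinset_le_card_roots_derivative_sdiff_roots_succ (Chebyshev.U ℝ m)
      change (gaussNodes m).card ≤ (innerLobattoNodes m \ gaussNodes m).card + 1 at h
      have h' : (innerLobattoNodes m \ gaussNodes m).card < (innerLobattoNodes m).card :=
        Finset.card_lt_card (Finset.ssubset_iff_of_subset Finset.sdiff_subset |>.2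
          ⟨0, (mem_innerLobattoNodes hm1).2 hd, fun h =>
            (Finset.mem_sdiff.1 h).2 (mem_gaussNodes.2 hU)⟩)
      rw [card_gaussNodes] at h
      rw [card_innerLobattoNodes] at h'
      omega
    simp only [lobattoNodes, Finset.mem_insert, not_or]
    exact ⟨by norm_num, by norm_num, fun h => hd ((mem_innerLobattoNodes hm1).1 h)⟩
  · refine ⟨⟨?_, hy.1.2⟩, fun x hx => ?_⟩
    · simp only [lobattoNodes, Finset.coe_insert]
      exact Or.inr (Or.inr hy.1.1)
    · have hx1 : x ∈ lobattoNodes m := hx.1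
      simp only [lobattoNodes, Finset.mem_insert] at hx1
      rcases hx1 with rfl | rfl | h
      · exact hy1.le
      · linarith [show (0 : ℝ) < -1 from hx.2]
      · exact hy.2 ⟨h, hx.2⟩

/-! ### The explicit extremal polynomials -/

/-- `D` as a polynomial in `z ^ 2`. -/
def quadD (y : ℝ) : ℝ[X] := X ^ 2 + C (2 * (1 - 2 * y ^ 2)) * X + 1

theorem natDegree_quadD (y : ℝ) : (quadD y).natDegree = 2 := by
  unfold quadD; compute_degree!

theorem quadD_ne_zero (y : ℝ) : quadD y ≠ 0 := by
  intro h
  have := natDegree_quadD y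
  simp [h] at this

theorem eval_map_quadD (y : ℝ) (z : ℂ) :
    ((quadD y).map Complex.ofRealHom).eval (z ^ 2) = D y z := by
  simp [quadD, D]; ring

/-- The roots of `quadD y` are `ζ²` and `ζ⁻²` with `ζ + ζ⁻¹ = 2y`. They are distinct for `0 < y <
1`, so it suffices to find a double root at each; the hypothesis is symmetric under `ζ ↦ ζ⁻¹` and is
used for both. -/
theorem quadD_sq_dvd {y : ℝ} (hy : y ∈ Ioo (0 : ℝ) 1) {p : ℝ[X]}
    (h : ∀ ζ : ℂ, ‖ζ‖ = 1 → ζ ≠ 0 → ζ + ζ⁻¹ = 2 * y → ζ ^ 2 - ζ⁻¹ ^ 2 ≠ 0 →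
      (p.map Complex.ofRealHom).eval (ζ ^ 2) = 0 ∧
        ((derivative p).map Complex.ofRealHom).eval (ζ ^ 2) = 0) :
    quadD y ^ 2 ∣ p := by
  have hs0 : 0 < 1 - y ^ 2 := by nlinarith [hy.1, hy.2]
  set s := √(1 - y ^ 2) with hs
  have hs1 : 0 < s := Real.sqrt_pos.2 hs0
  have hs2 : s ^ 2 = 1 - y ^ 2 := Real.sq_sqrt hs0.le
  have hs2' : (s : ℂ) ^ 2 = 1 - y ^ 2 := by exact_mod_cast hs2
  have hI := Complex.I_sq
  set ζ : ℂ := y + s * Complex.I with hζ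
  set ξ : ℂ := y - s * Complex.I with hξ
  have hmul : ζ * ξ = 1 := by
    rw [hζ, hξ]
    linear_combination (-(s : ℂ) ^ 2) * hI + hs2'
  have hζ0 : ζ ≠ 0 := left_ne_zero_of_mul_eq_one hmul
  have hξ0 : ξ ≠ 0 := right_ne_zero_of_mul_eq_one hmul
  have hinv : ζ⁻¹ = ξ := inv_eq_of_mul_eq_one_right hmul
  have hinv' : ξ⁻¹ = ζ := by rw [← hinv, inv_inv]
  have hconj : starRingEnd ℂ ζ = ξ := by simp [hζ, hξ, sub_eq_add_neg]
  have hn : ‖ζ‖ = 1 := by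
    have : ((‖ζ‖ ^ 2 : ℝ) : ℂ) = 1 := by
      rw [← Complex.normSq_eq_norm_sq, ← Complex.mul_conj, hconj, hmul]
    have : ‖ζ‖ ^ 2 = 1 := by exact_mod_cast this
    exact (pow_eq_one_iff_of_nonneg (norm_nonneg _) two_ne_zero).1 this
  have hn' : ‖ξ‖ = 1 := by rw [← hinv, norm_inv, hn, inv_one]
  have hsum : ζ + ξ = 2 * y := by rw [hζ, hξ]; ring
  have hne : ζ ^ 2 - ξ ^ 2 ≠ 0 := by
    have : ζ ^ 2 - ξ ^ 2 = 4 * y * s * Complex.I := by rw [hζ, hξ]; ring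
    rw [this]
    have h1 : (y : ℂ) ≠ 0 := by exact_mod_cast hy.1.ne'
    have h2 : (s : ℂ) ≠ 0 := by exact_mod_cast hs1.ne'
    simp [h1, h2]
  by_cases hp : p = 0
  · simp [hp]
  have hp' : p.map Complex.ofRealHom ≠ 0 := (Polynomial.map_ne_zero_iff Complex.ofReal_injective).2 hp
  have key : ∀ w : ℂ, (p.map Complex.ofRealHom).eval w = 0 →
      ((derivative p).map Complex.ofRealHom).eval w = 0 →
      (X - C w) ^ 2 ∣ p.map Complex.ofRealHom := by
    intro w h0 h1
    refine (le_rootMultiplicity_iff hp').1 ((one_lt_rootMultiplicity_iff_isRoot hp').2 ⟨h0, ?_⟩)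
    rw [IsRoot, derivative_map, h1]
  obtain ⟨a1, a2⟩ := h ζ hn hζ0 (by rw [hinv, hsum]) (by rwa [hinv])
  obtain ⟨b1, b2⟩ := h ξ hn' hξ0 (by rw [hinv', add_comm, hsum])
    (by rw [hinv']; exact fun h => hne (by linear_combination -h))
  rw [← Polynomial.map_dvd_map' Complex.ofRealHom]
  have hfac : (quadD y).map Complex.ofRealHom = (X - C (ζ ^ 2)) * (X - C (ξ ^ 2)) := by
    have e1 : (C (2 * (1 - 2 * (y : ℂ) ^ 2)) : ℂ[X]) = - (C (ζ ^ 2) + C (ξ ^ 2)) := by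
      rw [← C_add, ← C_neg]
      congr 1
      linear_combination (ζ + ξ + 2 * y) * hsum - 2 * hmul
    have e2 : (C (ζ ^ 2) * C (ξ ^ 2) : ℂ[X]) = 1 := by
      rw [← C_mul, ← mul_pow, hmul, one_pow, C_1]
    have e3 : (quadD y).map Complex.ofRealHom =
        X ^ 2 + C (2 * (1 - 2 * (y : ℂ) ^ 2)) * X + 1 := by
      simp [quadD]
    rw [e3, e1]
    linear_combination -e2
  rw [Polynomial.map_pow, hfac, mul_pow]
  exact (isCoprime_X_sub_C_of_isUnit_sub hne.isUnit).pow.mul_dvd (key _ a1 a2) (key _ b1 b2)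

theorem isCoprime_one_sub_X_quadD {y : ℝ} (hy : y ∈ Ioo (0 : ℝ) 1) :
    IsCoprime (1 - X) (quadD y) := by
  have hy2 : 1 - y ^ 2 ≠ 0 := by nlinarith [hy.1, hy.2]
  -- Division of `quadD y` by `1 - X` leaves the remainder `4 (1 - y²)`, its value at `1`.
  refine ⟨C ((4 * (1 - y ^ 2))⁻¹) * (X + C (3 - 4 * y ^ 2)), C ((4 * (1 - y ^ 2))⁻¹), ?_⟩
  have hc : (C ((4 * (1 - y ^ 2))⁻¹) : ℝ[X]) * C (4 * (1 - y ^ 2)) = 1 := by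
    rw [← C_mul, inv_mul_cancel₀ (mul_ne_zero four_ne_zero hy2), C_1]
  unfold quadD
  simp only [map_mul, map_sub, map_ofNat, map_one, map_pow] at hc ⊢
  linear_combination hc

/-- The properties of the polynomial represented by `F` that make it extremal. -/
structure IsExtremalPoly (m : ℕ) (y : ℝ) (F : ℂ → ℂ) (p : ℝ[X]) : Prop where
  natDegree_le : p.natDegree + 3 ≤ 2 * m
  coeff_even : ∀ j, p.coeff (2 * j) = 0
  coeff_one : p.coeff 1 = 1
  coeff_three : p.coeff 3 = 4 * y ^ 2 - 1
  nonneg : ∀ x ∈ Icc (-1 : ℝ) 1, 0 ≤ (sineQuot p).eval x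
  eval_eq : ∀ z : ℂ, 1 - z ^ 2 ≠ 0 → D y z ≠ 0 → (p.map Complex.ofRealHom).eval z = F z

theorem exists_joukowski_eq {x : ℝ} (hx : 1 < x) : ∃ z : ℝ, 1 < z ∧ (z + z⁻¹) / 2 = x := by
  have h : √(x ^ 2 - 1) ^ 2 = x ^ 2 - 1 := Real.sq_sqrt (by nlinarith)
  have h0 := Real.sqrt_nonneg (x ^ 2 - 1)
  refine ⟨x + √(x ^ 2 - 1), by linarith, ?_⟩
  rw [inv_eq_of_mul_eq_one_right (b := x - √(x ^ 2 - 1)) (by linear_combination -h)]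
  ring

/-- Only `z > 1` need be tested: there `z - z⁻¹`, `1 - z²` and `quadD` at `z²` are nonzero, so the
rational expressions are defined. -/
theorem eq_of_eval_joukowski {p q : ℝ[X]}
    (h : ∀ z : ℝ, 1 < z → p.eval ((z + z⁻¹) / 2) = q.eval ((z + z⁻¹) / 2)) : p = q := by
  refine eq_of_infinite_eval_eq _ _ ((Ioi_infinite (1 : ℝ)).mono fun x hx => ?_)
  obtain ⟨z, hz, rfl⟩ := exists_joukowski_eq hx
  exact h z hz

theorem coeff_expand_mul_X_even (Q : ℝ[X]) (j : ℕ) : (X * expand ℝ 2 Q).coeff (2 * j) = 0 := by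
  cases j with
  | zero => simp
  | succ j =>
    rw [show 2 * (j + 1) = (2 * j + 1) + 1 by ring, coeff_X_mul, coeff_expand two_pos,
      if_neg (by omega)]

theorem coeff_expand_mul_X_odd (Q : ℝ[X]) (j : ℕ) :
    (X * expand ℝ 2 Q).coeff (2 * j + 1) = Q.coeff j := by
  rw [coeff_X_mul, coeff_expand_mul' two_pos]

theorem natDegree_X_mul_expand_le (Q : ℝ[X]) :
    (X * expand ℝ 2 Q).natDegree ≤ 1 + 2 * Q.natDegree := by
  refine natDegree_mul_le.trans ?_
  rw [natDegree_expand, natDegree_X, mul_comm 2]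

/-- Numerator of `(G₁ + G₂) / z` in the variable `z ^ 2`. -/
def gaussNum (m : ℕ) (y : ℝ) : ℝ[X] :=
  C (16 * y ^ 2 * (1 - y ^ 2) / (m + 1)) * X ^ 2 * (1 - X ^ (m + 1)) + (1 - X ^ 2) * quadD y

theorem gaussNum_dvd {m : ℕ} {y : ℝ} (hy : y ∈ Ioo (0 : ℝ) 1)
    (hU : (Chebyshev.U ℝ m).eval y = 0) : (1 - X) * quadD y ^ 2 ∣ gaussNum m y := by
  refine (isCoprime_one_sub_X_quadD hy).pow_right.mul_dvd ?_ (quadD_sq_dvd hy ?_)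
  · rw [← neg_dvd, neg_sub, ← C_1, dvd_iff_isRoot]
    simp [gaussNum]
  · intro ζ hn h0 hsum hne
    -- `U_m(y) = 0` means that `ζ²` is an `(m + 1)`-st root of unity.
    have hω : (ζ ^ 2) ^ (m + 1) = 1 := by
      have h := eval_U_joukowski h0 (m + 1)
      have hU' : (Chebyshev.U ℂ m).eval (y : ℂ) = 0 := by
        rw [← Chebyshev.complex_ofReal_eval_U, hU, Complex.ofReal_zero]
      rw [hsum, Nat.cast_succ, add_sub_cancel_right, mul_div_cancel_left₀ _ two_ne_zero, hU',
        zero_mul, inv_pow] at h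
      have h1 : ζ ^ (m + 1) ≠ 0 := pow_ne_zero _ h0
      field_simp at h
      rw [← pow_mul, mul_comm, pow_mul]
      linear_combination -h
    have hω' : (ζ ^ 2) ^ m = (ζ ^ 2)⁻¹ := by
      rw [pow_succ] at hω
      exact eq_inv_of_mul_eq_one_left hω
    have hy2 : (y : ℂ) = (ζ + ζ⁻¹) / 2 := by rw [hsum]; ring
    have hm : (m : ℂ) + 1 ≠ 0 := by exact_mod_cast Nat.succ_ne_zero m
    -- At `ζ²` both summands vanish. In the derivative they cancel because the constant `16 y² (1 -
    -- y²)` equals `-(ζ² - ζ⁻²)²`.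
    constructor
    · simp only [gaussNum, quadD, Polynomial.map_add, Polynomial.map_mul, Polynomial.map_sub,
        Polynomial.map_pow, map_C, map_X, Polynomial.map_one, eval_add, eval_mul, eval_sub,
        eval_pow, eval_C, eval_X, eval_one, hω, Complex.ofRealHom_eq_coe]
      push_cast
      rw [hy2]
      field_simp
      ring
    · simp only [gaussNum, quadD, derivative_add, derivative_mul, derivative_C, derivative_sub,
        derivative_one, derivative_X_pow, derivative_X,
        Polynomial.map_add, Polynomial.map_mul, Polynomial.map_sub, Polynomial.map_zero,
        Polynomial.map_pow, map_C, map_X, Polynomial.map_one, eval_add, eval_mul, eval_sub,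
        eval_pow, eval_C, eval_X, eval_one, eval_zero, add_tsub_cancel_right,
        hω, hω', Complex.ofRealHom_eq_coe]
      push_cast
      rw [hy2]
      field_simp
      ring

theorem sq_sub_sq_joukowski {y z : ℝ} (hz : z ≠ 0) :
    ((z + z⁻¹) / 2) ^ 2 - y ^ 2 = (quadD y).eval (z ^ 2) / (4 * z ^ 2) := by
  simp only [quadD, eval_add, eval_mul, eval_pow, eval_C, eval_X, eval_one]
  field_simp
  ring

theorem quadD_eval_inv {y w : ℝ} (hw : w ≠ 0) :
    (quadD y).eval w⁻¹ = (quadD y).eval w / w ^ 2 := by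
  simp only [quadD, eval_add, eval_mul, eval_pow, eval_C, eval_X, eval_one]
  field_simp
  ring

theorem quadD_eval_pos {y : ℝ} (hy : y ∈ Ioo (0 : ℝ) 1) {w : ℝ} (hw : 1 < w) :
    0 < (quadD y).eval w := by
  simp only [quadD, eval_add, eval_mul, eval_pow, eval_C, eval_X, eval_one]
  nlinarith [mul_pos (show 0 < w by linarith) (show 0 < 1 - y ^ 2 by nlinarith [hy.1, hy.2])]

theorem eval_X_mul_expand (Q : ℝ[X]) (z : ℝ) : (X * expand ℝ 2 Q).eval z = z * Q.eval (z ^ 2) := by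
  rw [eval_mul, eval_X, expand_eval]

theorem eval_map_X_mul_expand (Q : ℝ[X]) (z : ℂ) :
    ((X * expand ℝ 2 Q).map Complex.ofRealHom).eval z =
      z * (Q.map Complex.ofRealHom).eval (z ^ 2) := by
  rw [Polynomial.map_mul, map_X, map_expand, eval_mul, eval_X, expand_eval]

theorem eval_sineQuot_real (p : ℝ[X]) {z : ℝ} (hz : 1 < z) :
    (sineQuot p).eval ((z + z⁻¹) / 2) = (p.eval z - p.eval z⁻¹) / (z - z⁻¹) := by
  have hz' : z⁻¹ < 1 := inv_lt_one_of_one_lt₀ hz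
  rw [eq_div_iff (by linarith)]
  simpa using eval_sineQuot_joukowski (RingHom.id ℝ) p (show z ≠ 0 by linarith)

/-- `N` is odd and `m = (N + 3) / 2`, or `N` is even and `m = (N + 2) / 2`. -/
def IsIndex (N m : ℕ) : Prop := (Odd N ∧ N + 3 = 2 * m) ∨ (Even N ∧ N + 2 = 2 * m)

theorem G₁_add_G₂_eq {N m : ℕ} (h : IsIndex N m) (y z : ℂ) : G₁ N y z + G₂ y z =
    16 * y ^ 2 * (1 - y ^ 2) * z ^ 5 * (1 - (z ^ 2) ^ (m + 1)) /
      ((m + 1) * ((1 - z ^ 2) * D y z ^ 2)) + (z + z ^ 3) / D y z := by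
  rw [G₁, G₂]
  congr 1
  generalize (1 - z ^ 2) * D y z ^ 2 = d
  rcases h with ⟨h1, h2⟩ | ⟨h1, h2⟩
  · rw [if_pos h1, ← pow_mul, show N + 5 = 2 * (m + 1) by omega,
      show (N : ℂ) + 5 = 2 * (m + 1) by exact_mod_cast (by omega : N + 5 = 2 * (m + 1))]
    simp only [div_eq_mul_inv, mul_inv]
    ring
  · rw [if_neg (Nat.not_odd_iff_even.2 h1), ← pow_mul, show N + 4 = 2 * (m + 1) by omega,
      show (N : ℂ) + 4 = 2 * (m + 1) by exact_mod_cast (by omega : N + 4 = 2 * (m + 1))]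
    simp only [div_eq_mul_inv, mul_inv]
    ring

theorem exists_gaussPoly {N m : ℕ} (hm : 2 ≤ m) (hN : IsIndex N m) {y : ℝ} (hy : y ∈ Ioo (0 : ℝ) 1)
    (hU : (Chebyshev.U ℝ m).eval y = 0) :
    ∃ p, IsExtremalPoly m y (fun z => G₁ N y z + G₂ y z) p := by
  obtain ⟨Q, hQ⟩ := gaussNum_dvd hy hU
  have hm0 : (m : ℝ) + 1 ≠ 0 := by positivity
  have hy2 : 0 < 1 - y ^ 2 := by nlinarith [hy.1, hy.2]
  have hX : (1 - X : ℝ[X]) ≠ 0 := fun h => by simpa [h] using natDegree_one_sub_X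
  have hQ0 : Q.coeff 0 = 1 := by
    have := congrArg (fun p : ℝ[X] => p.coeff 0) hQ
    simp [gaussNum, quadD, pow_two, mul_coeff_zero] at this
    exact this.symm
  have hQ1 : Q.coeff 1 = 4 * y ^ 2 - 1 := by
    have := congrArg (fun p : ℝ[X] => p.coeff 1) hQ
    simp [gaussNum, quadD, pow_two, mul_coeff_zero, mul_coeff_one, coeff_one, hQ0] at this
    linarith
  have hne : gaussNum m y ≠ 0 := by
    intro h
    have := congrArg (eval 0) h
    simp [gaussNum, quadD] at this
  have hdQ : Q.natDegree + 2 ≤ m := by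
    have h1 : (gaussNum m y).natDegree ≤ m + 3 := by
      unfold gaussNum
      refine natDegree_add_le_of_degree_le ?_ ?_
      · refine natDegree_mul_le.trans ?_
        have h1 : (C (16 * y ^ 2 * (1 - y ^ 2) / (m + 1)) * X ^ 2).natDegree ≤ 2 :=
          natDegree_C_mul_X_pow_le _ _
        have h2 : (1 - X ^ (m + 1) : ℝ[X]).natDegree ≤ m + 1 := by compute_degree
        omega
      · refine natDegree_mul_le.trans ?_
        have h2 : (1 - X ^ 2 : ℝ[X]).natDegree ≤ 2 := by compute_degree
        rw [natDegree_quadD]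
        omega
    rw [hQ] at h1 hne
    rw [natDegree_mul (left_ne_zero_of_mul hne) (right_ne_zero_of_mul hne),
      natDegree_mul hX (pow_ne_zero _ (quadD_ne_zero y)), natDegree_pow, natDegree_one_sub_X,
      natDegree_quadD] at h1
    omega
  -- This exhibits `sineQuot` as a positive multiple of `U_m² / (x² - y²)²`, which gives
  -- nonnegativity away from `±y`; continuity does the rest.
  have hid : sineQuot (X * expand ℝ 2 Q) * (X ^ 2 - C y ^ 2) ^ 2 =
      C (y ^ 2 * (1 - y ^ 2) / (m + 1)) * Chebyshev.U ℝ m ^ 2 := by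
    refine eq_of_eval_joukowski fun z hz => ?_
    have hz0 : z ≠ 0 := by linarith
    have hz2 : 1 < z ^ 2 := by nlinarith
    have hzz : z ^ 2 - 1 ≠ 0 := by linarith
    have hzz' : 1 - z ^ 2 ≠ 0 := by linarith
    have hsub : z - z⁻¹ ≠ 0 := by
      have : z⁻¹ < 1 := inv_lt_one_of_one_lt₀ hz
      linarith
    have hD := (quadD_eval_pos hy hz2).ne'
    have hinv := quadD_eval_inv (y := y) (w := z ^ 2) (by positivity)
    have hUe : (Chebyshev.U ℝ m).eval ((z + z⁻¹) / 2) =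
        (z ^ (m + 1) - z⁻¹ ^ (m + 1)) / (z - z⁻¹) := by
      rw [eq_div_iff hsub]
      have := eval_U_joukowski hz0 (m + 1)
      rwa [Nat.cast_succ, add_sub_cancel_right] at this
    have hQe : ∀ w : ℝ, (1 - w) ≠ 0 → (quadD y).eval w ≠ 0 → Q.eval w =
        (gaussNum m y).eval w / ((1 - w) * (quadD y).eval w ^ 2) := by
      intro w h1 h2
      rw [hQ, eq_div_iff (by positivity)]
      simp
      ring
    have hw' : 1 - (z ^ 2)⁻¹ ≠ 0 := by
      field_simp
      exact div_ne_zero hzz (by positivity)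
    have h1 := hQe (z ^ 2) hzz' hD
    have h2 := hQe (z ^ 2)⁻¹ hw' (by rw [hinv]; positivity)
    rw [eval_mul, eval_mul, eval_pow, eval_sub, eval_pow, eval_pow, eval_X, eval_C, eval_C,
      sq_sub_sq_joukowski hz0, eval_sineQuot_real _ hz, eval_X_mul_expand, eval_X_mul_expand,
      inv_pow, h1, h2, eval_pow, hUe]
    simp only [gaussNum, eval_add, eval_mul, eval_sub, eval_pow, eval_C, eval_X, eval_one, hinv]
    generalize (quadD y).eval (z ^ 2) = d at hD ⊢
    have hpow : (z ^ 2) ^ (m + 1) = (z ^ (m + 1)) ^ 2 := by ring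
    simp only [inv_pow, hpow]
    have he : z ^ (m + 1) ≠ 0 := by positivity
    generalize z ^ (m + 1) = e at he ⊢
    field_simp
    ring
  refine ⟨X * expand ℝ 2 Q, ?_, coeff_expand_mul_X_even Q, ?_, ?_, ?_, fun z hz1 hz2 => ?_⟩
  · have := natDegree_X_mul_expand_le Q
    omega
  · rw [← hQ0]; exact coeff_expand_mul_X_odd Q 0
  · rw [← hQ1]; exact coeff_expand_mul_X_odd Q 1
  · refine eval_nonneg_of_Ioo_diff_finite (F := {y, -y}) (by simp) fun x hx hxy => ?_
    simp only [mem_insert_iff, mem_singleton_iff, not_or] at hxy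
    have h := congrArg (eval x) hid
    simp only [eval_mul, eval_pow, eval_sub, eval_C, eval_X] at h
    have h0 : x ^ 2 - y ^ 2 ≠ 0 := by
      rw [sq_sub_sq]
      exact mul_ne_zero (fun h => hxy.2 (by linarith)) (fun h => hxy.1 (by linarith))
    have h1 : 0 < (x ^ 2 - y ^ 2) ^ 2 := by positivity
    refine nonneg_of_mul_nonneg_left (b := (x ^ 2 - y ^ 2) ^ 2) ?_ h1
    rw [h]
    positivity
  · have h := congrArg (fun p : ℝ[X] => (p.map Complex.ofRealHom).eval (z ^ 2)) hQ
    have hm0' : (m : ℂ) + 1 ≠ 0 := by exact_mod_cast Nat.succ_ne_zero m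
    simp only [gaussNum, Polynomial.map_add, Polynomial.map_mul, Polynomial.map_sub,
        Polynomial.map_pow, map_C, map_X, Polynomial.map_one, eval_add, eval_mul, eval_sub,
        eval_pow, eval_C, eval_X, eval_one, eval_map_quadD, Complex.ofRealHom_eq_coe] at h
    push_cast at h
    rw [eq_comm, mul_comm _ (eval _ _), ← eq_div_iff (mul_ne_zero hz1 (pow_ne_zero 2 hz2))] at h
    rw [eval_map_X_mul_expand, G₁_add_G₂_eq hN, h]
    field_simp
    ring

/-! ### The extremal polynomial built from Lobatto nodes. -/

theorem G₃_add_G₄_eq {N k : ℕ} (h : IsIndex N (k + 1)) (y z : ℂ) : G₃ N y z + G₄ N y z =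
    -16 * y ^ 2 * (1 - y ^ 2) * z ^ 7 *
      ((k + 3) ^ 2 * (1 - (z ^ 2) ^ (k + 1)) + (k + 1) ^ 2 * (1 - (z ^ 2) ^ (k + 3)) -
        2 * (k + 1) * (k + 3) * (z ^ 2 - (z ^ 2) ^ (k + 2))) /
      ((k + 1) * (k + 2) * (k + 3) * ((1 - z ^ 2) ^ 3 * D y z ^ 2)) +
    (z + z ^ 3) * (1 + z ^ 8 - 4 * y ^ 2 * (z ^ 2 + z ^ 6) +
      2 * (-(8 / (k + 2)) * y ^ 4 + 4 * (1 + 2 / (k + 2)) * y ^ 2 - 1) * z ^ 4) /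
      ((1 - z ^ 2) ^ 2 * D y z ^ 2) := by
  have h0 : ∀ a b : ℕ, a = b → (a : ℂ) = b := fun a b h => congrArg _ h
  have hk2 : (k : ℂ) + 2 ≠ 0 := by exact_mod_cast Nat.succ_ne_zero (k + 1)
  have e1 : (8 : ℂ) / (k + 2) = 16 / (2 * (k + 2)) := by field_simp; norm_num
  have e2 : (2 : ℂ) / (k + 2) = 4 / (2 * (k + 2)) := by field_simp; norm_num
  rw [G₃, G₄, γ₁, γ₂, e1, e2]
  generalize (1 - z ^ 2) ^ 2 * D y z ^ 2 = d
  rcases h with ⟨h1, h2⟩ | ⟨h1, h2⟩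
  · have a1 := h0 (N + 3) (2 * (k + 1)) (by omega)
    have a2 := h0 (N + 5) (2 * (k + 2)) (by omega)
    have a3 := h0 (N + 7) (2 * (k + 3)) (by omega)
    push_cast at a1 a2 a3
    rw [if_pos h1, if_pos h1, a1, a2, a3, ← pow_mul, ← pow_mul, ← pow_mul,
      show N + 3 = 2 * (k + 1) by omega, show N + 5 = 2 * (k + 2) by omega,
      show N + 7 = 2 * (k + 3) by omega]
    congr 1
    simp only [div_eq_mul_inv, mul_inv]
    ring
  · have a1 := h0 (N + 2) (2 * (k + 1)) (by omega)
    have a2 := h0 (N + 4) (2 * (k + 2)) (by omega)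
    have a3 := h0 (N + 6) (2 * (k + 3)) (by omega)
    push_cast at a1 a2 a3
    have h1' := Nat.not_odd_iff_even.2 h1
    rw [if_neg h1', if_neg h1', a1, a2, a3, ← pow_mul, ← pow_mul, ← pow_mul,
      show N + 2 = 2 * (k + 1) by omega, show N + 4 = 2 * (k + 2) by omega,
      show N + 6 = 2 * (k + 3) by omega]
    congr 1
    simp only [div_eq_mul_inv, mul_inv]
    ring

/-- Numerator of `(G₃ + G₄) / z` in the variable `z ^ 2`. -/
def lobattoNum (k : ℕ) (y : ℝ) : ℝ[X] :=
  C (-16 * y ^ 2 * (1 - y ^ 2) / ((k + 1) * (k + 2) * (k + 3))) * X ^ 3 *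
      (C ((k + 3 : ℝ) ^ 2) * (1 - X ^ (k + 1)) + C ((k + 1 : ℝ) ^ 2) * (1 - X ^ (k + 3)) -
        C (2 * (k + 1) * (k + 3 : ℝ)) * (X - X ^ (k + 2))) +
    (1 - X ^ 2) * (1 + X ^ 4 - C (4 * y ^ 2) * (X + X ^ 3) +
      C (2 * (-(8 / (k + 2)) * y ^ 4 + 4 * (1 + 2 / (k + 2)) * y ^ 2 - 1)) * X ^ 2)

/-- The value and the first two derivatives at `1` vanish for every `y`. The coefficient of `X ^ 2`
coming from `γ₂` is exactly the one for which the first derivative vanishes. -/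
theorem one_sub_X_pow_three_dvd_lobattoNum (k : ℕ) (y : ℝ) : (1 - X) ^ 3 ∣ lobattoNum k y := by
  have h1 : (k : ℝ) + 1 ≠ 0 := by positivity
  have h2 : (k : ℝ) + 2 ≠ 0 := by positivity
  have h3 : (k : ℝ) + 3 ≠ 0 := by positivity
  by_cases h : lobattoNum k y = 0
  · simp [h]
  have key : (X - C 1) ^ 3 ∣ lobattoNum k y := by
    refine (le_rootMultiplicity_iff h).1
      ((lt_rootMultiplicity_iff_isRoot_iterate_derivative h).2 fun n hn => ?_)
    interval_cases n
    · simp [lobattoNum]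
    · simp [lobattoNum]
      field_simp
      ring
    · simp only [lobattoNum, IsRoot, Function.iterate_succ, Function.iterate_zero,
        Function.comp_apply, id_eq, derivative_add, derivative_mul, derivative_C, derivative_sub,
        derivative_one, derivative_zero, derivative_X_pow, derivative_X, eval_add, eval_mul,
        eval_sub, eval_pow, eval_C, eval_X, eval_one, eval_zero, one_pow, Nat.add_sub_cancel,
        show k + 3 - 1 = k + 2 by omega, show k + 2 - 1 = k + 1 by omega]
      push_cast
      field_simp
      ring
  rwa [← neg_sub, Odd.neg_pow (by decide), neg_dvd, ← C_1]

theorem lobattoNum_dvd {k : ℕ} {y : ℝ} (hy : y ∈ Ioo (0 : ℝ) 1)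
    (hU : (derivative (Chebyshev.U ℝ ((k + 1 : ℕ) : ℤ))).eval y = 0) :
    (1 - X) ^ 3 * quadD y ^ 2 ∣ lobattoNum k y := by
  refine (isCoprime_one_sub_X_quadD hy).pow.mul_dvd (one_sub_X_pow_three_dvd_lobattoNum k y)
    (quadD_sq_dvd hy ?_)
  intro ζ hn h0 hsum hne
  have hk1 : (k : ℂ) + 1 ≠ 0 := by exact_mod_cast Nat.succ_ne_zero k
  have hk2 : (k : ℂ) + 2 ≠ 0 := by exact_mod_cast Nat.succ_ne_zero (k + 1)
  have hk3 : (k : ℂ) + 3 ≠ 0 := by exact_mod_cast Nat.succ_ne_zero (k + 2)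
  -- The two terms have different absolute values because `|ζ| = 1`.
  have hden : ((k : ℂ) + 3) - (k + 1) * ζ ^ 2 ≠ 0 := by
    intro h
    have h' := congrArg norm (sub_eq_zero.1 h)
    rw [norm_mul, norm_pow, hn, one_pow, mul_one] at h'
    have h'' : ((k + 3 : ℕ) : ℝ) = ((k + 1 : ℕ) : ℝ) := by
      rw [← Complex.norm_natCast, ← Complex.norm_natCast]
      push_cast
      exact h'
    have := Nat.cast_injective (R := ℝ) h''
    omega
  -- `U'_{k+1}(y) = 0` means `(k + 3) U_k(y) = (k + 1) U_{k+2}(y)`. In terms of `ζ` this expresses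
  -- `ζ^{2k}` rationally through `ζ²`, which eliminates all `k`-dependent powers from the double
  -- root conditions.
  have hω : (ζ ^ 2) ^ k * ((ζ ^ 2) ^ 2 * ((k + 3) - (k + 1) * ζ ^ 2)) =
      (k + 3) * ζ ^ 2 - (k + 1) := by
    have h1 := eval_U_joukowski h0 (k + 1)
    have h2 := eval_U_joukowski h0 (k + 3)
    have e1 : (((k + 1 : ℕ) : ℤ) - 1) = (k : ℤ) := by push_cast; ring
    have e2 : (((k + 3 : ℕ) : ℤ) - 1) = ((k + 2 : ℕ) : ℤ) := by push_cast; ring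
    have h3 := congrArg (eval y) (one_sub_sq_mul_derivative_U k)
    rw [eval_mul, hU, mul_zero, eval_mul, eval_C, eval_sub, eval_mul, eval_mul, eval_C, eval_C,
      eq_comm, mul_eq_zero] at h3
    have h4 := h3.resolve_left (by norm_num)
    have h5 : ((k : ℂ) + 3) * (Chebyshev.U ℂ k).eval (y : ℂ) -
        (k + 1) * (Chebyshev.U ℂ ((k + 2 : ℕ) : ℤ)).eval (y : ℂ) = 0 := by
      rw [← Chebyshev.complex_ofReal_eval_U, ← Chebyshev.complex_ofReal_eval_U]
      exact_mod_cast h4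
    rw [hsum, mul_div_cancel_left₀ _ two_ne_zero, e1] at h1
    rw [hsum, mul_div_cancel_left₀ _ two_ne_zero, e2] at h2
    have h6 : ((k : ℂ) + 3) * (ζ ^ (k + 1) - ζ⁻¹ ^ (k + 1)) =
        (k + 1) * (ζ ^ (k + 3) - ζ⁻¹ ^ (k + 3)) := by
      rw [← h1, ← h2]
      linear_combination (ζ - ζ⁻¹) * h5
    simp only [pow_succ, inv_pow] at h6
    have hp : (ζ ^ 2) ^ k = (ζ ^ k) ^ 2 := by ring
    rw [hp]
    have hk : ζ ^ k ≠ 0 := pow_ne_zero _ h0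
    generalize ζ ^ k = e at h6 hk ⊢
    field_simp at h6
    linear_combination h6
  obtain ⟨d, hd⟩ : ∃ d, d = (k : ℂ) + 3 - (k + 1) * ζ ^ 2 := ⟨_, rfl⟩
  rw [← hd] at hω hden
  have hω' := eq_div_of_mul_eq (mul_ne_zero (pow_ne_zero 2 (pow_ne_zero 2 h0)) hden) hω
  have hy2 : (y : ℂ) = (ζ + ζ⁻¹) / 2 := by rw [hsum]; ring
  constructor
  · simp only [lobattoNum, Polynomial.map_add, Polynomial.map_mul, Polynomial.map_sub,
      Polynomial.map_pow, map_C, map_X, Polynomial.map_one, eval_add, eval_mul, eval_sub,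
      eval_pow, eval_C, eval_X, eval_one, pow_add (ζ ^ 2) k, hω', Complex.ofRealHom_eq_coe]
    push_cast
    rw [hy2]
    field_simp
    rw [hd]
    ring
  · simp only [lobattoNum, derivative_add, derivative_mul, derivative_C, derivative_sub,
      derivative_one, derivative_X_pow, derivative_X,
      Polynomial.map_add, Polynomial.map_mul, Polynomial.map_sub, Polynomial.map_zero,
      Polynomial.map_pow, map_C, map_X, Polynomial.map_one, eval_add, eval_mul, eval_sub,
      eval_pow, eval_C, eval_X, eval_one, eval_zero, Nat.add_sub_cancel,
      show k + 3 - 1 = k + 2 by omega, show k + 2 - 1 = k + 1 by omega,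
      pow_add (ζ ^ 2) k, hω', Complex.ofRealHom_eq_coe]
    push_cast
    rw [hy2]
    field_simp
    rw [hd]
    ring

theorem exists_lobattoPoly {N k : ℕ} (hk : 2 ≤ k) (hN : IsIndex N (k + 1)) {y : ℝ}
    (hy : y ∈ Ioo (0 : ℝ) 1)
    (hU : (derivative (Chebyshev.U ℝ ((k + 1 : ℕ) : ℤ))).eval y = 0) :
    ∃ p, IsExtremalPoly (k + 1) y (fun z => G₃ N y z + G₄ N y z) p := by
  obtain ⟨Q, hQ⟩ := lobattoNum_dvd hy hU
  have hk1 : (k : ℝ) + 1 ≠ 0 := by positivity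
  have hk2 : (k : ℝ) + 2 ≠ 0 := by positivity
  have hk3 : (k : ℝ) + 3 ≠ 0 := by positivity
  have hy2 : 0 < 1 - y ^ 2 := by nlinarith [hy.1, hy.2]
  have hX : (1 - X : ℝ[X]) ≠ 0 := fun h => by simpa [h] using natDegree_one_sub_X
  have hQ0 : Q.coeff 0 = 1 := by
    have := congrArg (fun p : ℝ[X] => p.coeff 0) hQ
    simp [lobattoNum, quadD, pow_succ, mul_coeff_zero] at this
    exact this.symm
  have hQ1 : Q.coeff 1 = 4 * y ^ 2 - 1 := by
    have := congrArg (fun p : ℝ[X] => p.coeff 1) hQ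
    simp [lobattoNum, quadD, pow_succ, mul_coeff_zero, mul_coeff_one, coeff_one, hQ0] at this
    linarith
  have hne : lobattoNum k y ≠ 0 := by
    intro h
    have := congrArg (eval 0) h
    simp [lobattoNum] at this
  have hdQ : Q.natDegree + 1 ≤ k := by
    have h1 : (lobattoNum k y).natDegree ≤ k + 6 := by
      unfold lobattoNum
      refine natDegree_add_le_of_degree_le ?_ ?_
      · refine natDegree_mul_le.trans ?_
        have h1 : (C (-16 * y ^ 2 * (1 - y ^ 2) / ((k + 1) * (k + 2) * (k + 3))) * X ^ 3).natDegree
            ≤ 3 := natDegree_C_mul_X_pow_le _ _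
        have h2 : (C ((k + 3 : ℝ) ^ 2) * (1 - X ^ (k + 1)) + C ((k + 1 : ℝ) ^ 2) *
            (1 - X ^ (k + 3)) - C (2 * (k + 1) * (k + 3 : ℝ)) * (X - X ^ (k + 2))).natDegree ≤
            k + 3 := by
          compute_degree
        omega
      · have : ((1 - X ^ 2) * (1 + X ^ 4 - C (4 * y ^ 2) * (X + X ^ 3) +
          C (2 * (-(8 / (k + 2)) * y ^ 4 + 4 * (1 + 2 / (k + 2)) * y ^ 2 - 1)) * X ^ 2)).natDegree
            ≤ 6 := by compute_degree
        omega
    rw [hQ] at h1 hne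
    rw [natDegree_mul (left_ne_zero_of_mul hne) (right_ne_zero_of_mul hne),
      natDegree_mul (pow_ne_zero _ hX) (pow_ne_zero _ (quadD_ne_zero y)), natDegree_pow,
      natDegree_pow, natDegree_one_sub_X, natDegree_quadD] at h1
    omega
  -- The squared bracket is `2 (1 - x²) U'_{k+1}`, so `sineQuot` is a positive multiple of `(1 - x²)
  -- U'_{k+1}² / (x² - y²)²`.
  have hid : sineQuot (X * expand ℝ 2 Q) * ((X ^ 2 - C y ^ 2) ^ 2 * (1 - X ^ 2)) =
      C (y ^ 2 * (1 - y ^ 2) / (4 * ((k + 1) * (k + 2) * (k + 3)))) *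
        (C (k + 3 : ℝ) * Chebyshev.U ℝ k - C (k + 1 : ℝ) * Chebyshev.U ℝ ((k + 2 : ℕ) : ℤ)) ^ 2 := by
    refine eq_of_eval_joukowski fun z hz => ?_
    have hz0 : z ≠ 0 := by linarith
    have hz2 : 1 < z ^ 2 := by nlinarith
    have hzz : z ^ 2 - 1 ≠ 0 := by linarith
    have hzz' : 1 - z ^ 2 ≠ 0 := by linarith
    have hsub : z - z⁻¹ ≠ 0 := by
      have : z⁻¹ < 1 := inv_lt_one_of_one_lt₀ hz
      linarith
    have hD := (quadD_eval_pos hy hz2).ne'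
    have hinv := quadD_eval_inv (y := y) (w := z ^ 2) (by positivity)
    have hUe : (Chebyshev.U ℝ k).eval ((z + z⁻¹) / 2) =
        (z ^ (k + 1) - z⁻¹ ^ (k + 1)) / (z - z⁻¹) := by
      rw [eq_div_iff hsub]
      have := eval_U_joukowski hz0 (k + 1)
      rwa [Nat.cast_succ, add_sub_cancel_right] at this
    have hUe2 : (Chebyshev.U ℝ ((k + 2 : ℕ) : ℤ)).eval ((z + z⁻¹) / 2) =
        (z ^ (k + 3) - z⁻¹ ^ (k + 3)) / (z - z⁻¹) := by
      rw [eq_div_iff hsub]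
      have := eval_U_joukowski hz0 (k + 2 + 1)
      rwa [Nat.cast_succ, add_sub_cancel_right] at this
    have hQe : ∀ w : ℝ, (1 - w) ≠ 0 → (quadD y).eval w ≠ 0 → Q.eval w =
        (lobattoNum k y).eval w / ((1 - w) ^ 3 * (quadD y).eval w ^ 2) := by
      intro w h1 h2
      rw [hQ, eq_div_iff (mul_ne_zero (pow_ne_zero 3 h1) (pow_ne_zero 2 h2))]
      simp
      ring
    have hw' : 1 - (z ^ 2)⁻¹ ≠ 0 := by
      field_simp
      exact div_ne_zero hzz (by positivity)
    have h1 := hQe (z ^ 2) hzz' hD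
    have h2 := hQe (z ^ 2)⁻¹ hw' (by rw [hinv]; positivity)
    rw [eval_mul, eval_mul, eval_mul, eval_pow, eval_sub, eval_sub, eval_pow, eval_pow, eval_X,
      eval_C, eval_C, eval_one, sq_sub_sq_joukowski hz0, eval_sineQuot_real _ hz,
      eval_X_mul_expand, eval_X_mul_expand, inv_pow, h1, h2, eval_pow, eval_sub, eval_mul,
      eval_mul, eval_C, eval_C, hUe, hUe2]
    simp only [lobattoNum, eval_add, eval_mul, eval_sub, eval_pow, eval_C, eval_X, eval_one, hinv]
    generalize (quadD y).eval (z ^ 2) = d at hD ⊢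
    have hpow : (z ^ 2) ^ k = (z ^ k) ^ 2 := by ring
    simp only [inv_pow, pow_add _ k, hpow]
    have he : z ^ k ≠ 0 := by positivity
    generalize z ^ k = e at he ⊢
    field_simp
    ring
  refine ⟨X * expand ℝ 2 Q, ?_, coeff_expand_mul_X_even Q, ?_, ?_, ?_, fun z hz1 hz2 => ?_⟩
  · have := natDegree_X_mul_expand_le Q
    omega
  · rw [← hQ0]; exact coeff_expand_mul_X_odd Q 0
  · rw [← hQ1]; exact coeff_expand_mul_X_odd Q 1
  · refine eval_nonneg_of_Ioo_diff_finite (F := {y, -y}) (by simp) fun x hx hxy => ?_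
    simp only [mem_insert_iff, mem_singleton_iff, not_or] at hxy
    have h := congrArg (eval x) hid
    rw [eval_mul] at h
    have h0 : x ^ 2 - y ^ 2 ≠ 0 := by
      rw [sq_sub_sq]
      exact mul_ne_zero (fun h => hxy.2 (by linarith)) (fun h => hxy.1 (by linarith))
    have h1 : 0 < (x ^ 2 - y ^ 2) ^ 2 := by positivity
    have h2 : 0 < 1 - x ^ 2 := by nlinarith [hx.1, hx.2]
    refine nonneg_of_mul_nonneg_left (b := eval x ((X ^ 2 - C y ^ 2) ^ 2 * (1 - X ^ 2))) ?_ ?_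
    · rw [h, eval_mul, eval_pow, eval_C]
      positivity
    · simpa using mul_pos h1 h2
  · have h := congrArg (fun p : ℝ[X] => (p.map Complex.ofRealHom).eval (z ^ 2)) hQ
    have hk1' : (k : ℂ) + 1 ≠ 0 := by exact_mod_cast hk1
    have hk2' : (k : ℂ) + 2 ≠ 0 := by exact_mod_cast hk2
    have hk3' : (k : ℂ) + 3 ≠ 0 := by exact_mod_cast hk3
    simp only [lobattoNum, Polynomial.map_add, Polynomial.map_mul, Polynomial.map_sub,
        Polynomial.map_pow, map_C, map_X, Polynomial.map_one, eval_add, eval_mul, eval_sub,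
        eval_pow, eval_C, eval_X, eval_one, eval_map_quadD, Complex.ofRealHom_eq_coe] at h
    push_cast at h
    rw [eq_comm, mul_comm _ (eval _ _),
      ← eq_div_iff (mul_ne_zero (pow_ne_zero 3 hz1) (pow_ne_zero 2 hz2))] at h
    rw [eval_map_X_mul_expand, G₃_add_G₄_eq hN, h]
    field_simp
    ring

/-! ### The extremal problem -/

/-- Real polynomials whose complexifications make up `TypRealLE N`. -/
structure IsAdmissible (N : ℕ) (q : ℝ[X]) : Prop where
  natDegree_le : q.natDegree ≤ N
  coeff_zero : q.coeff 0 = 0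
  coeff_one : q.coeff 1 = 1
  nonneg : ∀ x ∈ Icc (-1 : ℝ) 1, 0 ≤ (sineQuot q).eval x

theorem mem_typRealLE_iff {N : ℕ} {P : ℂ[X]} :
    P ∈ TypRealLE N ↔ ∃ q, IsAdmissible N q ∧ P = q.map Complex.ofRealHom := by
  constructor
  · rintro ⟨h1, h2, h3, h4⟩
    obtain ⟨q, rfl⟩ := h4.exists_real
    refine ⟨q, ⟨?_, ?_, ?_, h4.sineQuot_nonneg⟩, rfl⟩
    · rwa [natDegree_map] at h1
    · simpa using h2
    · simpa using h3
  · rintro ⟨q, hq, rfl⟩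
    refine ⟨by rw [natDegree_map]; exact hq.natDegree_le, by simp [hq.coeff_zero],
      by simp [hq.coeff_one], typicallyReal_of_sineQuot_nonneg (by simp [hq.coeff_one]) hq.nonneg⟩

theorem typReal_eq_sep (N : ℕ) : TypReal N = {P | P ∈ TypRealLE N ∧ P.natDegree = N} := by
  ext P
  constructor
  · rintro ⟨h1, h2⟩
    exact ⟨⟨h1.le, h2⟩, h1⟩
  · rintro ⟨⟨_, h2⟩, h1⟩
    exact ⟨h1, h2⟩

/-- The members of `C` at which `ε` times the third coefficient is largest. -/
def extremizers (ε : ℝ) (C : Set ℂ[X]) : Set ℂ[X] :=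
  {P | P ∈ C ∧ ∀ Q ∈ C, ε * (Q.coeff 3).re ≤ ε * (P.coeff 3).re}

theorem extremizers_one (C : Set ℂ[X]) : extremizers 1 C = maximizers C := by
  simp [extremizers, maximizers]

theorem extremizers_neg_one (C : Set ℂ[X]) : extremizers (-1) C = minimizers C := by
  simp [extremizers, minimizers]

theorem extremizers_eq {ε v : ℝ} (hε : ε ≠ 0) {C : Set ℂ[X]}
    (hC : ∀ Q ∈ C, ε * (Q.coeff 3).re ≤ ε * v) {P : ℂ[X]} (hP : P ∈ C) (hPv : (P.coeff 3).re = v) :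
    extremizers ε C = {Q | Q ∈ C ∧ (Q.coeff 3).re = v} := by
  ext Q
  constructor
  · rintro ⟨h1, h2⟩
    refine ⟨h1, mul_left_cancel₀ hε (le_antisymm (hC Q h1) ?_)⟩
    rw [← hPv]
    exact h2 P hP
  · rintro ⟨h1, h2⟩
    exact ⟨h1, fun R hR => by rw [h2]; exact hC R hR⟩

theorem IsIndex.add_two_le {N m : ℕ} (h : IsIndex N m) : N + 2 ≤ 2 * m ∧ 2 * m ≤ N + 3 := by
  rcases h with ⟨_, h⟩ | ⟨_, h⟩ <;> omega

section

variable {N m : ℕ} {s : Finset ℝ} {ε y : ℝ} {F : ℂ → ℂ} {p q : ℝ[X]}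

theorem IsAdmissible.coeff_three_le (hq : IsAdmissible N q) (hN : 1 ≤ N) (hi : IsIndex N m)
    (hs : IsNodeSet m s) (hy : IsExtremalNode ε s y) :
    ε * q.coeff 3 ≤ ε * (4 * y ^ 2 - 1) ∧ (q.coeff 3 = 4 * y ^ 2 - 1 →
        ∏ x ∈ (s.erase y).erase (-y), nodeFactor x ∣ sineQuot q) := by
  have hd : (sineQuot q).natDegree + 2 ≤ 2 * m - 1 := by
    have := natDegree_sineQuot_le q
    have := hq.natDegree_le
    have := hi.add_two_le
    omega
  obtain ⟨h1, h2⟩ := hs.chebFun_le hy hq.nonneg hd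
  rw [chebFun_sineQuot_mul_sq, chebFun_sineQuot, hq.coeff_one] at h1 h2
  refine ⟨by linarith, fun h => h2 ?_⟩
  rw [h]
  ring

theorem IsExtremalPoly.isAdmissible (hp : IsExtremalPoly m y F p) (hi : IsIndex N m) :
    IsAdmissible N p := by
  refine ⟨?_, hp.coeff_even 0, hp.coeff_one, hp.nonneg⟩
  have := hp.natDegree_le
  have := hi.add_two_le
  omega

theorem IsExtremalPoly.sineQuot_ne_zero (hp : IsExtremalPoly m y F p) : sineQuot p ≠ 0 := by
  intro h
  have := chebFun_sineQuot p
  rw [h, map_zero, hp.coeff_one] at this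
  exact zero_ne_one this

/-- The explicit polynomial attains the bound, so the forced zeros divide its `sineQuot`; both
degrees are at most `2m - 4`, with equality for the divisor, so the cofactor is constant. -/
theorem IsExtremalPoly.sineQuot_eq (hp : IsExtremalPoly m y F p) (hN : 1 ≤ N) (hi : IsIndex N m)
    (hs : IsNodeSet m s) (hy : IsExtremalNode ε s y) :
    ∃ c : ℝ, c ≠ 0 ∧ sineQuot p = C c * ∏ x ∈ (s.erase y).erase (-y), nodeFactor x := by
  obtain ⟨r, hr⟩ := ((hp.isAdmissible hi).coeff_three_le hN hi hs hy).2 hp.coeff_three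
  have h0 := hp.sineQuot_ne_zero
  have hd := natDegree_sineQuot_le p
  have := hp.natDegree_le
  have := hs.natDegree_prod_erase hy
  rw [hr] at h0
  have hr0 := right_ne_zero_of_mul h0
  rw [hr, natDegree_mul (left_ne_zero_of_mul h0) hr0] at hd
  rw [eq_C_of_natDegree_eq_zero (show r.natDegree = 0 by omega)] at hr hr0
  exact ⟨_, by simpa using hr0, by rw [hr, mul_comm]⟩

theorem IsExtremalPoly.natDegree_sineQuot (hp : IsExtremalPoly m y F p) (hN : 1 ≤ N)
    (hi : IsIndex N m) (hs : IsNodeSet m s) (hy : IsExtremalNode ε s y) :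
    (sineQuot p).natDegree + 4 = 2 * m := by
  obtain ⟨c, hc, h⟩ := hp.sineQuot_eq hN hi hs hy
  rw [h, natDegree_C_mul hc, hs.natDegree_prod_erase hy]

theorem IsExtremalPoly.exists_sineQuot_eq_mul (hp : IsExtremalPoly m y F p) (hN : 1 ≤ N)
    (hi : IsIndex N m) (hs : IsNodeSet m s) (hy : IsExtremalNode ε s y) (hq : IsAdmissible N q)
    (h3 : q.coeff 3 = 4 * y ^ 2 - 1) :
    ∃ τ : ℝ, sineQuot q = sineQuot p * (1 + C τ * X) ∧ (N + 3 = 2 * m → τ = 0) := by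
  obtain ⟨c, hc, h⟩ := hp.sineQuot_eq hN hi hs hy
  have hdvd : sineQuot p ∣ sineQuot q := by
    rw [h]
    exact (IsUnit.mul_left_dvd (isUnit_C.2 hc.isUnit)).2 ((hq.coeff_three_le hN hi hs hy).2 h3)
  obtain ⟨r, hr⟩ := hdvd
  have hq1 := chebFun_sineQuot q
  rw [hq.coeff_one] at hq1
  have hr0 : r ≠ 0 := by
    rintro rfl
    rw [hr, mul_zero, map_zero] at hq1
    exact zero_ne_one hq1
  have hdeg : r.natDegree + 2 * m ≤ N + 3 := by
    have h1 := natDegree_sineQuot_le q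
    have := hq.natDegree_le
    have := hp.natDegree_sineQuot hN hi hs hy
    rw [hr, natDegree_mul hp.sineQuot_ne_zero hr0] at h1
    omega
  -- The cofactor is at most linear. Its constant term is `1`, because `chebFun (sineQuot q) = 1`
  -- while the linear part contributes a multiple of `p.coeff 2 = 0`.
  have hr1 : r = C (r.coeff 1) * X + C (r.coeff 0) := by
    have := hi.add_two_le
    exact eq_X_add_C_of_natDegree_le_one (by omega)
  have e : sineQuot q = r.coeff 1 • (sineQuot p * X) + r.coeff 0 • sineQuot p := by
    rw [hr]
    conv_lhs => rw [hr1]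
    simp only [smul_eq_C_mul]
    ring
  rw [e, map_add, map_smul, map_smul, chebFun_sineQuot_mul_X, chebFun_sineQuot, hp.coeff_one,
    hp.coeff_even 1] at hq1
  have hc0 : r.coeff 0 = 1 := by simpa using hq1
  refine ⟨r.coeff 1, ?_, fun h => coeff_eq_zero_of_natDegree_lt (by omega)⟩
  rw [e, hc0, one_smul, smul_eq_C_mul]
  ring

/-- The polynomial `p(z) (1 + τ (z + z⁻¹) / 2) - τ / 2`. -/
def tilt (τ : ℝ) (p : ℝ[X]) : ℝ[X] := p + C (τ / 2) * (X * p + divX p - 1)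

theorem eval_map_tilt {K : Type*} [Field K] [CharZero K] (f : ℝ →+* K) (τ : ℝ)
    (h0 : p.coeff 0 = 0) {z : K} (hz : z ≠ 0) : ((tilt τ p).map f).eval z =
      (p.map f).eval z * (1 + f τ * ((z + z⁻¹) / 2)) - f τ / 2 := by
  have h : (p.map f).eval z = ((divX p).map f).eval z * z := by
    conv_lhs => rw [← divX_mul_X_add p, h0]
    simp
  have h' : ((divX p).map f).eval z = (p.map f).eval z * z⁻¹ := by
    rw [h, mul_inv_cancel_right₀ hz]
  simp only [tilt, Polynomial.map_add, Polynomial.map_mul, Polynomial.map_sub, map_C, map_X,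
    Polynomial.map_one, eval_add, eval_mul, eval_sub, eval_C, eval_X, eval_one, h', map_div₀,
    map_ofNat]
  ring

theorem sineQuot_tilt (τ : ℝ) (h0 : p.coeff 0 = 0) :
    sineQuot (tilt τ p) = sineQuot p * (1 + C τ * X) := by
  refine eq_of_eval_joukowski fun z hz => ?_
  have hz0 : z ≠ 0 := by linarith
  have h1 := eval_map_tilt (RingHom.id ℝ) τ h0 hz0
  have h2 := eval_map_tilt (RingHom.id ℝ) τ h0 (inv_ne_zero hz0)
  simp only [Polynomial.map_id, RingHom.id_apply, inv_inv] at h1 h2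
  rw [eval_mul, eval_sineQuot_real _ hz, eval_sineQuot_real _ hz, h1, h2, eval_add, eval_mul,
    eval_one, eval_C, eval_X]
  ring

theorem tilt_zero : tilt 0 p = p := by simp [tilt]

theorem IsExtremalPoly.tilt_coeff_three (hp : IsExtremalPoly m y F p) (τ : ℝ) :
    (tilt τ p).coeff 3 = 4 * y ^ 2 - 1 := by
  have h2 := hp.coeff_even 1
  have h4 := hp.coeff_even 2
  norm_num at h2 h4
  have h1 : (1 : ℝ[X]).coeff 3 = 0 := by rw [Polynomial.coeff_one]; simp
  simp [tilt, coeff_X_mul, coeff_divX, h1, hp.coeff_three, h2, h4]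

theorem IsExtremalPoly.tilt_isAdmissible (hp : IsExtremalPoly m y F p) (hN : N + 2 = 2 * m)
    {τ : ℝ} (hτ : τ ∈ Icc (-1 : ℝ) 1) : IsAdmissible N (tilt τ p) := by
  have h0 : p.coeff 0 = 0 := hp.coeff_even 0
  have h2 : p.coeff 2 = 0 := hp.coeff_even 1
  refine ⟨?_, ?_, ?_, fun x hx => ?_⟩
  · have h1 := hp.natDegree_le
    unfold tilt
    refine natDegree_add_le_of_degree_le (by omega) ((natDegree_C_mul_le _ _).trans ?_)
    refine (natDegree_sub_le _ _).trans (max_le (natDegree_add_le_of_degree_le ?_ ?_) (by simp))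
    · exact natDegree_mul_le.trans (by rw [natDegree_X]; omega)
    · rw [natDegree_divX_eq_natDegree_tsub_one]; omega
  · simp [tilt, coeff_divX, h0, hp.coeff_one]
  · have h1 : (1 : ℝ[X]).coeff 1 = 0 := by rw [Polynomial.coeff_one]; simp
    simp [tilt, coeff_X_mul, coeff_divX, h1, hp.coeff_one, h0, h2]
  · rw [sineQuot_tilt τ h0, eval_mul]
    refine mul_nonneg (hp.nonneg x hx) ?_
    simp only [eval_add, eval_one, eval_mul, eval_C, eval_X]
    -- `2 (1 + τ x) = (1 - τ)(1 - x) + (1 + τ)(1 + x)`.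
    nlinarith [hτ.1, hτ.2, hx.1, hx.2, mul_nonneg (sub_nonneg.2 hτ.2) (sub_nonneg.2 hx.2),
      mul_nonneg (sub_nonneg.2 hτ.1) (sub_nonneg.2 hx.1),
      mul_nonneg (sub_nonneg.2 hτ.2) (sub_nonneg.2 hx.1),
      mul_nonneg (sub_nonneg.2 hτ.1) (sub_nonneg.2 hx.2)]

theorem IsExtremalPoly.natDegree_tilt (hp : IsExtremalPoly m y F p) (hN : 1 ≤ N)
    (he : Even N) (hNm : N + 2 = 2 * m) (hs : IsNodeSet m s) (hy : IsExtremalNode ε s y) {τ : ℝ}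
    (hτ : τ ∈ Icc (-1 : ℝ) 1) : (tilt τ p).natDegree = N ↔ τ ≠ 0 := by
  constructor
  · rintro h rfl
    have := hp.natDegree_le
    rw [tilt_zero] at h
    omega
  · intro h0
    refine le_antisymm (hp.tilt_isAdmissible hNm hτ).natDegree_le ?_
    have h1 := natDegree_sineQuot_le (tilt τ p)
    have h2 : (1 + C τ * X : ℝ[X]).natDegree = 1 := by
      rw [add_comm, ← C_1, natDegree_linear h0]
    have h3 : (1 + C τ * X : ℝ[X]) ≠ 0 := by
      intro h
      rw [h, natDegree_zero] at h2
      exact zero_ne_one h2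
    rw [sineQuot_tilt τ (hp.coeff_even 0), natDegree_mul hp.sineQuot_ne_zero h3, h2] at h1
    have := hp.natDegree_sineQuot hN (Or.inr ⟨he, hNm⟩) hs hy
    omega

theorem mem_Icc_of_mul_nonneg {u : ℝ[X]} (hu : u ≠ 0) (h : ∀ x ∈ Icc (-1 : ℝ) 1, 0 ≤ u.eval x)
    {τ : ℝ} (hτ : ∀ x ∈ Icc (-1 : ℝ) 1, 0 ≤ (u * (1 + C τ * X)).eval x) : τ ∈ Icc (-1 : ℝ) 1 := by
  have key : ∀ x ∈ Icc (-1 : ℝ) 1, 0 ≤ (1 + C τ * X : ℝ[X]).eval x := by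
    -- The factor `u` is positive off its finitely many roots and can be cancelled there; continuity
    -- covers the roots and the endpoints.
    refine eval_nonneg_of_Ioo_diff_finite (finite_setOfPred_isRoot hu) fun x hx hxu => ?_
    have hx' := Ioo_subset_Icc_self hx
    have h1 := hτ x hx'
    rw [eval_mul] at h1
    exact nonneg_of_mul_nonneg_right h1 (lt_of_le_of_ne (h x hx') fun h => hxu h.symm)
  have h1 := key 1 (by norm_num)
  have h2 := key (-1) (by norm_num)
  simp at h1 h2
  exact ⟨by linarith, by linarith⟩

end

/-! ### From real polynomials back to the classes of complex polynomials. -/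

theorem finite_singularSet (y : ℝ) : (singularSet y).Finite := by
  have hne : (1 - X ^ 2 : ℂ[X]) * expand ℂ 2 ((quadD y).map Complex.ofRealHom) ≠ 0 := by
    intro h
    have := congrArg (eval 0) h
    simp [quadD] at this
  refine (finite_setOfPred_isRoot hne).subset ?_
  intro z hz
  change eval z _ = 0
  rw [eval_mul, expand_eval, eval_map_quadD, mul_eq_zero]
  rcases hz with h | h
  · left; simpa using h
  · exact Or.inr h

theorem poleFreeRep_of_eq {P : ℂ[X]} {F : ℂ → ℂ} {S : Set ℂ} (hS : S.Finite)
    (h : ∀ z, z ∉ S → P.eval z = F z) : PoleFreeRep P F S := by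
  refine ⟨h, fun z₀ _ => ?_⟩
  have hP : Tendsto (fun z => P.eval z) (𝓝[≠] z₀) (𝓝 (P.eval z₀)) :=
    P.continuous.continuousAt.tendsto.mono_left nhdsWithin_le_nhds
  refine hP.congr' ?_
  have hev : ∀ᶠ z in 𝓝 z₀, z ∉ S \ {z₀} :=
    (hS.subset sdiff_subset).isClosed.isOpen_compl.mem_nhds (by simp)
  filter_upwards [nhdsWithin_le_nhds hev, self_mem_nhdsWithin] with z hz hz0
  exact h z fun hzS => hz ⟨hzS, hz0⟩

section

variable {N m : ℕ} {s : Finset ℝ} {ε y : ℝ} {F : ℂ → ℂ} {p : ℝ[X]}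

theorem re_coeff_three_le (hN : 1 ≤ N) (hi : IsIndex N m) (hs : IsNodeSet m s)
    (hy : IsExtremalNode ε s y) {Q : ℂ[X]} (hQ : Q ∈ TypRealLE N) :
    ε * (Q.coeff 3).re ≤ ε * (4 * y ^ 2 - 1) := by
  obtain ⟨q, hq, rfl⟩ := mem_typRealLE_iff.1 hQ
  simpa using (hq.coeff_three_le hN hi hs hy).1

theorem coeff_map_three (h : p.coeff 3 = 4 * y ^ 2 - 1) :
    (p.map Complex.ofRealHom).coeff 3 = 4 * (y : ℂ) ^ 2 - 1 := by
  rw [coeff_map, h]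
  simp

theorem IsExtremalPoly.odd_case (hp : IsExtremalPoly m y F p) (hε : ε ≠ 0) (hN : 1 ≤ N)
    (ho : Odd N) (hNm : N + 3 = 2 * m) (hs : IsNodeSet m s) (hy : IsExtremalNode ε s y) :
    ∃ P : ℂ[X], PoleFreeRep P F (singularSet y) ∧ P.coeff 3 = 4 * (y : ℂ) ^ 2 - 1 ∧
      extremizers ε (TypReal N) = {P} ∧ extremizers ε (TypRealLE N) = {P} := by
  have hi : IsIndex N m := Or.inl ⟨ho, hNm⟩
  have h3 := coeff_map_three hp.coeff_three
  have hre : ((p.map Complex.ofRealHom).coeff 3).re = 4 * y ^ 2 - 1 := by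
    rw [coeff_map, hp.coeff_three, Complex.ofRealHom_eq_coe, Complex.ofReal_re]
  have hmem : p.map Complex.ofRealHom ∈ TypRealLE N :=
    mem_typRealLE_iff.2 ⟨p, hp.isAdmissible hi, rfl⟩
  have hdeg : (p.map Complex.ofRealHom).natDegree = N := by
    rw [natDegree_map]
    have := hp.natDegree_sineQuot hN hi hs hy
    have := natDegree_sineQuot_le p
    have := (hp.isAdmissible hi).natDegree_le
    -- Needed because of the truncated `p.natDegree - 1`: for `N = 1` the degree bound alone would
    -- allow `p.natDegree = 0`.
    have : 1 ≤ p.natDegree := le_natDegree_of_ne_zero (by rw [hp.coeff_one]; exact one_ne_zero)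
    omega
  have hun : ∀ Q ∈ TypRealLE N, (Q.coeff 3).re = 4 * y ^ 2 - 1 → Q = p.map Complex.ofRealHom := by
    intro Q hQ hQ3
    obtain ⟨q, hq, rfl⟩ := mem_typRealLE_iff.1 hQ
    obtain ⟨τ, h1, h2⟩ := hp.exists_sineQuot_eq_mul hN hi hs hy hq (by simpa using hQ3)
    rw [h2 hNm] at h1
    congr 1
    refine sineQuot_inj ?_ (by simpa using h1)
    rw [hq.coeff_zero, show p.coeff 0 = 0 from hp.coeff_even 0]
  have hb : ∀ Q ∈ TypRealLE N, ε * (Q.coeff 3).re ≤ ε * (4 * y ^ 2 - 1) := fun Q hQ =>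
    re_coeff_three_le hN hi hs hy hQ
  refine ⟨p.map Complex.ofRealHom, poleFreeRep_of_eq (finite_singularSet y) fun z hz => ?_, h3,
    ?_, ?_⟩
  · exact hp.eval_eq z (fun h => hz (Or.inl h)) fun h => hz (Or.inr h)
  · rw [typReal_eq_sep, extremizers_eq (C := {P | P ∈ TypRealLE N ∧ P.natDegree = N}) hε (fun Q hQ => hb Q hQ.1) ⟨hmem, hdeg⟩ hre]
    ext Q
    exact ⟨fun h => hun Q h.1.1 h.2, by rintro rfl; exact ⟨⟨hmem, hdeg⟩, hre⟩⟩
  · rw [extremizers_eq hε hb hmem hre]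
    ext Q
    exact ⟨fun h => hun Q h.1 h.2, by rintro rfl; exact ⟨hmem, hre⟩⟩

theorem IsExtremalPoly.even_case (hp : IsExtremalPoly m y F p) (hε : ε ≠ 0) (hN : 1 ≤ N)
    (he : Even N) (hNm : N + 2 = 2 * m) (hs : IsNodeSet m s) (hy : IsExtremalNode ε s y) :
    ∃ P : ℝ → ℂ[X], (∀ τ ∈ Icc (-1 : ℝ) 1,
        PoleFreeRep (P τ) (withTau τ F) (insert 0 (singularSet y)) ∧
        (P τ).coeff 3 = 4 * (y : ℂ) ^ 2 - 1) ∧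
      extremizers ε (TypReal N) = P '' (Icc (-1 : ℝ) 1 \ {0}) ∧
      extremizers ε (TypRealLE N) = P '' Icc (-1 : ℝ) 1 := by
  have hi : IsIndex N m := Or.inr ⟨he, hNm⟩
  have h0 : p.coeff 0 = 0 := hp.coeff_even 0
  set P : ℝ → ℂ[X] := fun τ => (tilt τ p).map Complex.ofRealHom with hP
  have hre : ∀ τ, ((P τ).coeff 3).re = 4 * y ^ 2 - 1 := fun τ => by
    rw [hP, coeff_map, hp.tilt_coeff_three, Complex.ofRealHom_eq_coe, Complex.ofReal_re]
  have hmem : ∀ τ ∈ Icc (-1 : ℝ) 1, P τ ∈ TypRealLE N := fun τ hτ =>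
    mem_typRealLE_iff.2 ⟨_, hp.tilt_isAdmissible hNm hτ, rfl⟩
  have hdeg : ∀ τ ∈ Icc (-1 : ℝ) 1, ((P τ).natDegree = N ↔ τ ≠ 0) := fun τ hτ => by
    rw [hP, natDegree_map]
    exact hp.natDegree_tilt hN he hNm hs hy hτ
  have hun : ∀ Q ∈ TypRealLE N, (Q.coeff 3).re = 4 * y ^ 2 - 1 → ∃ τ ∈ Icc (-1 : ℝ) 1, P τ = Q := by
    intro Q hQ hQ3
    obtain ⟨q, hq, rfl⟩ := mem_typRealLE_iff.1 hQ
    obtain ⟨τ, h1, -⟩ := hp.exists_sineQuot_eq_mul hN hi hs hy hq (by simpa using hQ3)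
    have hτ : τ ∈ Icc (-1 : ℝ) 1 := mem_Icc_of_mul_nonneg hp.sineQuot_ne_zero hp.nonneg
      (by rw [← h1]; exact hq.nonneg)
    refine ⟨τ, hτ, congrArg _ (sineQuot_inj ?_ ?_)⟩
    · rw [hq.coeff_zero, (hp.tilt_isAdmissible hNm hτ).coeff_zero]
    · rw [h1, sineQuot_tilt τ h0]
  have hb : ∀ Q ∈ TypRealLE N, ε * (Q.coeff 3).re ≤ ε * (4 * y ^ 2 - 1) := fun Q hQ =>
    re_coeff_three_le hN hi hs hy hQ
  have h1 : (1 : ℝ) ∈ Icc (-1 : ℝ) 1 := by norm_num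
  refine ⟨P, fun τ hτ => ⟨poleFreeRep_of_eq ((finite_singularSet y).insert 0) fun z hz => ?_,
    coeff_map_three (hp.tilt_coeff_three τ)⟩, ?_, ?_⟩
  · rw [mem_insert_iff, not_or] at hz
    rw [hP, eval_map_tilt _ _ h0 hz.1,
      hp.eval_eq z (fun h => hz.2 (Or.inl h)) fun h => hz.2 (Or.inr h)]
    rfl
  -- The parameter `τ = 1` serves as a member of exact degree `N` attaining the bound; `τ = 0` would
  -- have smaller degree.
  · rw [typReal_eq_sep, extremizers_eq (C := {P | P ∈ TypRealLE N ∧ P.natDegree = N}) hε (fun Q hQ => hb Q hQ.1)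
      ⟨hmem 1 h1, (hdeg 1 h1).2 one_ne_zero⟩ (hre 1)]
    ext Q
    constructor
    · rintro ⟨⟨hQ, hd⟩, hQ3⟩
      obtain ⟨τ, hτ, rfl⟩ := hun Q hQ hQ3
      exact ⟨τ, ⟨hτ, (hdeg τ hτ).1 hd⟩, rfl⟩
    · rintro ⟨τ, ⟨hτ, hτ0⟩, rfl⟩
      exact ⟨⟨hmem τ hτ, (hdeg τ hτ).2 hτ0⟩, hre τ⟩
  · rw [extremizers_eq hε hb (hmem 1 h1) (hre 1)]
    ext Q
    constructor
    · rintro ⟨hQ, hQ3⟩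
      obtain ⟨τ, hτ, rfl⟩ := hun Q hQ hQ3
      exact ⟨τ, hτ, rfl⟩
    · rintro ⟨τ, hτ, rfl⟩
      exact ⟨hmem τ hτ, hre τ⟩

end

end RogosinskiSzego

end

/-! ### The six cases. -/

theorem theoremB (N : ℕ) (hN : 1 ≤ N) :
    -- case (a)
    (Odd N →
      ∃ y : ℝ, IsGreatest (rootsU ((N + 3) / 2)) y ∧ ∃ P : ℂ[X],
        PoleFreeRep P (fun z => G₁ N y z + G₂ y z) (singularSet y) ∧
        P.coeff 3 = 4 * (y : ℂ) ^ 2 - 1 ∧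
        maximizers (TypReal N) = {P} ∧
        maximizers (TypRealLE N) = {P}) ∧
    -- case (b)
    (Even N →
      ∃ y : ℝ, IsGreatest (rootsU ((N + 2) / 2)) y ∧ ∃ P : ℝ → ℂ[X],
        (∀ τ ∈ Icc (-1 : ℝ) 1,
          PoleFreeRep (P τ) (withTau τ fun z => G₁ N y z + G₂ y z) (insert 0 (singularSet y)) ∧
          (P τ).coeff 3 = 4 * (y : ℂ) ^ 2 - 1) ∧
        maximizers (TypReal N) = P '' (Icc (-1 : ℝ) 1 \ {0}) ∧
        maximizers (TypRealLE N) = P '' Icc (-1 : ℝ) 1) ∧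
    -- case (c)
    (Odd N → Odd ((N + 3) / 2) →
      ∃ y : ℝ, IsMinPos (rootsDU ((N + 3) / 2)) y ∧ ∃ P : ℂ[X],
        PoleFreeRep P (fun z => G₃ N y z + G₄ N y z) (singularSet y) ∧
        P.coeff 3 = 4 * (y : ℂ) ^ 2 - 1 ∧
        minimizers (TypReal N) = {P} ∧
        minimizers (TypRealLE N) = {P}) ∧
    -- case (d)
    (Odd N → Even ((N + 3) / 2) →
      ∃ y : ℝ, IsMinPos (rootsU ((N + 3) / 2)) y ∧ ∃ P : ℂ[X],
        PoleFreeRep P (fun z => G₁ N y z + G₂ y z) (singularSet y) ∧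
        P.coeff 3 = 4 * (y : ℂ) ^ 2 - 1 ∧
        minimizers (TypReal N) = {P} ∧
        minimizers (TypRealLE N) = {P}) ∧
    -- case (e)
    (Even N → Odd ((N + 2) / 2) →
      ∃ y : ℝ, IsMinPos (rootsDU ((N + 2) / 2)) y ∧ ∃ P : ℝ → ℂ[X],
        (∀ τ ∈ Icc (-1 : ℝ) 1,
          PoleFreeRep (P τ) (withTau τ fun z => G₃ N y z + G₄ N y z) (insert 0 (singularSet y)) ∧
          (P τ).coeff 3 = 4 * (y : ℂ) ^ 2 - 1) ∧
        minimizers (TypReal N) = P '' (Icc (-1 : ℝ) 1 \ {0}) ∧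
        minimizers (TypRealLE N) = P '' Icc (-1 : ℝ) 1) ∧
    -- case (f)
    (Even N → Even ((N + 2) / 2) →
      ∃ y : ℝ, IsMinPos (rootsU ((N + 2) / 2)) y ∧ ∃ P : ℝ → ℂ[X],
        (∀ τ ∈ Icc (-1 : ℝ) 1,
          PoleFreeRep (P τ) (withTau τ fun z => G₁ N y z + G₂ y z) (insert 0 (singularSet y)) ∧
          (P τ).coeff 3 = 4 * (y : ℂ) ^ 2 - 1) ∧
        minimizers (TypReal N) = P '' (Icc (-1 : ℝ) 1 \ {0}) ∧
        minimizers (TypRealLE N) = P '' Icc (-1 : ℝ) 1) := by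
  refine ⟨fun ho => ?_, fun he => ?_, fun ho hpar => ?_, fun ho hpar => ?_, fun he hpar => ?_,
    fun he hpar => ?_⟩
  · have hm : N + 3 = 2 * ((N + 3) / 2) := by obtain ⟨k, hk⟩ := ho; omega
    generalize (N + 3) / 2 = m at hm ⊢
    obtain ⟨y, hy, hs⟩ := exists_maximal_gaussNode (m := m) (by omega)
    obtain ⟨p, hp⟩ := exists_gaussPoly (by omega) (Or.inl ⟨ho, hm⟩) hs.mem_Ioo hy.1
    refine ⟨y, hy, ?_⟩
    simp only [← extremizers_one]
    exact hp.odd_case one_ne_zero hN ho hm (isNodeSet_gaussNodes (by omega)) hs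
  · have hm : N + 2 = 2 * ((N + 2) / 2) := by obtain ⟨k, hk⟩ := he; omega
    generalize (N + 2) / 2 = m at hm ⊢
    obtain ⟨y, hy, hs⟩ := exists_maximal_gaussNode (m := m) (by omega)
    obtain ⟨p, hp⟩ := exists_gaussPoly (by omega) (Or.inr ⟨he, hm⟩) hs.mem_Ioo hy.1
    refine ⟨y, hy, ?_⟩
    simp only [← extremizers_one]
    exact hp.even_case one_ne_zero hN he hm (isNodeSet_gaussNodes (by omega)) hs
  · have hm : N + 3 = 2 * ((N + 3) / 2) := by obtain ⟨k, hk⟩ := ho; omega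
    generalize (N + 3) / 2 = m at hm hpar ⊢
    have hm3 : 3 ≤ m := by obtain ⟨k, hk⟩ := hpar; omega
    obtain ⟨y, hy, hs⟩ := exists_minimal_lobattoNode hm3 hpar
    obtain ⟨k, rfl⟩ : ∃ k, m = k + 1 := ⟨m - 1, by omega⟩
    obtain ⟨p, hp⟩ := exists_lobattoPoly (by omega) (Or.inl ⟨ho, hm⟩) hs.mem_Ioo hy.1.1
    refine ⟨y, hy, ?_⟩
    simp only [← extremizers_neg_one]
    exact hp.odd_case (neg_ne_zero.2 one_ne_zero) hN ho hm (isNodeSet_lobattoNodes (by omega)) hs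
  · have hm : N + 3 = 2 * ((N + 3) / 2) := by obtain ⟨k, hk⟩ := ho; omega
    generalize (N + 3) / 2 = m at hm hpar ⊢
    obtain ⟨y, hy, hs⟩ := exists_minimal_gaussNode (m := m) (by omega) hpar
    obtain ⟨p, hp⟩ := exists_gaussPoly (by omega) (Or.inl ⟨ho, hm⟩) hs.mem_Ioo hy.1.1
    refine ⟨y, hy, ?_⟩
    simp only [← extremizers_neg_one]
    exact hp.odd_case (neg_ne_zero.2 one_ne_zero) hN ho hm (isNodeSet_gaussNodes (by omega)) hs
  · have hm : N + 2 = 2 * ((N + 2) / 2) := by obtain ⟨k, hk⟩ := he; omega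
    generalize (N + 2) / 2 = m at hm hpar ⊢
    have hm3 : 3 ≤ m := by obtain ⟨k, hk⟩ := hpar; omega
    obtain ⟨y, hy, hs⟩ := exists_minimal_lobattoNode hm3 hpar
    obtain ⟨k, rfl⟩ : ∃ k, m = k + 1 := ⟨m - 1, by omega⟩
    obtain ⟨p, hp⟩ := exists_lobattoPoly (by omega) (Or.inr ⟨he, hm⟩) hs.mem_Ioo hy.1.1
    refine ⟨y, hy, ?_⟩
    simp only [← extremizers_neg_one]
    exact hp.even_case (neg_ne_zero.2 one_ne_zero) hN he hm (isNodeSet_lobattoNodes (by omega)) hs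
  · have hm : N + 2 = 2 * ((N + 2) / 2) := by obtain ⟨k, hk⟩ := he; omega
    generalize (N + 2) / 2 = m at hm hpar ⊢
    obtain ⟨y, hy, hs⟩ := exists_minimal_gaussNode (m := m) (by omega) hpar
    obtain ⟨p, hp⟩ := exists_gaussPoly (by omega) (Or.inr ⟨he, hm⟩) hs.mem_Ioo hy.1.1
    refine ⟨y, hy, ?_⟩
    simp only [← extremizers_neg_one]
    exact hp.even_case (neg_ne_zero.2 one_ne_zero) hN he hm (isNodeSet_gaussNodes (by omega)) hs
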